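/- Let $q$ be a complex number with $0<|q|<1$. Write $$(x;q)_n=\prod_{i=0}^{n-1}(1-q^ix),\qquad (x;q)_\infty=\prod_{i\ge 0}(1-q^ix),\qquad j(x;q)=(x;q)_\infty(q/x;q)_\infty(q;q)_\infty,$$ and, for integers $a$ and $m\ge 1$, $$J_{a,m}=j(q^a;q^m),\qquad \overline{J}_{a,m}=j(-q^a;q^m),\qquad J_m=J_{m,3m}=\prod_{i\ge 1}(1-q^{mi}).$$ Let $$g(x,q)=x^{-1}\Big(-1+\sum_{n=0}^{\infty}\frac{q^{n^2}}{(x;q)_{n+1}(q/x;q)_n}\Big)$$ be the universal mock theta function, and let $$\overline{\phi}_0(q)=\sum_{n=0}^{\infty}q^n(-q;q)_{2n+1},\qquad \overline{\phi}_1(q)=\sum_{n=0}^{\infty}q^n(-q;q)_{2n}$$ be the mock theta functions of Bringmann, Hikami and Lovejoy. Then all the series below converge, no denominator vanishes, and $$q\,\overline{\phi}_0(q)=-1+q\,g(-q,q^8)+\frac{\overline{J}_{2,4}\,\overline{J}_{3,8}}{J_2},$$ $$\overline{\phi}_1(q)=-q^2\,g(-q^3,q^8)+\frac{\overline{J}_{2,4}\,\overline{J}_{1,8}}{J_2}.$$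 -/

import Mathlib

namespace MockTheta

/-- The finite `q`-shifted factorial `(x; q)_n`. -/
noncomputable def qPoch (x q : ℂ) (n : ℕ) : ℂ :=
  ∏ i ∈ Finset.range n, (1 - q ^ i * x)

/-- The infinite `q`-shifted factorial `(x; q)_∞`. -/
noncomputable def qPochInf (x q : ℂ) : ℂ :=
  ∏' i : ℕ, (1 - q ^ i * x)

/-- The product defining `(x; q)_∞` converges for `|q| < 1`, so `qPochInf` is not a junk value. -/
theorem multipliable_qPochInf (x q : ℂ) (hq : ‖q‖ < 1) :
    Multipliable (fun i : ℕ => 1 - q ^ i * x) := by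
  have h : Summable (fun i : ℕ => ‖-(q ^ i * x)‖) := by
    simp only [norm_neg, norm_mul, norm_pow]
    exact (summable_geometric_of_lt_one (norm_nonneg q) hq).mul_right _
  simpa [sub_eq_add_neg] using multipliable_one_add_of_summable h

/-- The theta function `j(x; q) = (x; q)_∞ (q/x; q)_∞ (q; q)_∞`. -/
noncomputable def theta (x q : ℂ) : ℂ :=
  qPochInf x q * qPochInf (q / x) q * qPochInf q q

/-- `J_{a,m} = j(q^a; q^m)`. -/
noncomputable def J (a : ℤ) (m : ℕ) (q : ℂ) : ℂ :=
  theta (q ^ a) (q ^ m)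

/-- `J̄_{a,m} = j(-q^a; q^m)`. -/
noncomputable def Jbar (a : ℤ) (m : ℕ) (q : ℂ) : ℂ :=
  theta (-q ^ a) (q ^ m)

/-- `J_m = J_{m,3m}`. -/
noncomputable def Jsingle (m : ℕ) (q : ℂ) : ℂ :=
  J m (3 * m) q

/-- The denominator `(x; q)_{n+1} (q/x; q)_n` in the series for `g(x, q)`. -/
noncomputable def gDenom (x q : ℂ) (n : ℕ) : ℂ :=
  qPoch x q (n + 1) * qPoch (q / x) q n

/-- The universal mock theta function
`g(x, q) = x⁻¹ (-1 + ∑_{n ≥ 0} q^{n²} / ((x; q)_{n+1} (q/x; q)_n))`. -/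
noncomputable def g (x q : ℂ) : ℂ :=
  x⁻¹ * (-1 + ∑' n : ℕ, q ^ (n ^ 2) / gDenom x q n)

/-- The expression defining `g(x, q)` makes sense: there is no division by zero
and the series converges. -/
def GDefined (x q : ℂ) : Prop :=
  x ≠ 0 ∧ (∀ n : ℕ, gDenom x q n ≠ 0) ∧ Summable (fun n : ℕ => q ^ (n ^ 2) / gDenom x q n)

/-- The general term of `φ̄₀(q)`. -/
noncomputable def phiBar0Term (q : ℂ) (n : ℕ) : ℂ :=
  q ^ n * qPoch (-q) q (2 * n + 1)

/-- The general term of `φ̄₁(q)`. -/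
noncomputable def phiBar1Term (q : ℂ) (n : ℕ) : ℂ :=
  q ^ n * qPoch (-q) q (2 * n)

/-- `φ̄₀(q) = ∑_{n ≥ 0} q^n (-q; q)_{2n+1}`. -/
noncomputable def phiBar0 (q : ℂ) : ℂ :=
  ∑' n : ℕ, phiBar0Term q n

/-- `φ̄₁(q) = ∑_{n ≥ 0} q^n (-q; q)_{2n}`. -/
noncomputable def phiBar1 (q : ℂ) : ℂ :=
  ∑' n : ℕ, phiBar1Term q n

end MockTheta

/-!
Fix `p` with `p² = q`. Splitting `∑ (-q; q)_n p^n` according to the parity of `n` gives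
`φ̄₁(q) + p φ̄₀(q)`. Iterating the functional equation of Fine's series `∑ (x; q)_n t^n` turns the
same sum into `p⁻¹ (-1 + ∑ p^{n²} / (p; p²)_n)`, and pairing consecutive terms here gives
`g(p, p⁴)`.

Partial fractions together with the Durfee rectangle identity write `g(x, q)` as the Appell–Lerch
series `∑ (-1)^n q^{3n(n+1)/2} / (1 - x q^n)` divided by `(q; q)_∞`, so that `θ(x; q) g(x, q)`
extends to a holomorphic function on `ℂ ∖ {0}`. After multiplication by theta functions, the
relation expressing `g(x, q)` through `g(-q x², q⁴)` and `g(-q³ x², q⁴)` becomes the statement that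
a function holomorphic on `ℂ ∖ {0}` and invariant under `x ↦ q x` is constant, which is Liouville's
theorem on the compact quotient; the constant is read off at `x = 1`.

Specialising this relation to `g(p, p⁴)` introduces `g(-q, q⁸)` and `g(-q³, q⁸)`, and since the
result holds for both square roots `±p` of `q`, its even and odd parts in `p` are the two
identities.
-/

namespace MockTheta

open Filter Topology

variable {q x : ℂ}

theorem norm_pow_lt_one (hq1 : ‖q‖ < 1) {m : ℕ} (hm : m ≠ 0) : ‖q ^ m‖ < 1 := by
  simpa only [norm_pow] using pow_lt_one₀ (norm_nonneg q) hq1 hm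

theorem pow_mul_self_ne_one (hq1 : ‖q‖ < 1) (i : ℕ) : q ^ i * q ≠ 1 := fun h => by
  have hlt := norm_pow_lt_one hq1 i.succ_ne_zero
  rw [Nat.succ_eq_add_one, pow_succ, h, norm_one] at hlt
  exact hlt.false

theorem exists_norm_le_of_tendsto {E : Type*} [SeminormedAddCommGroup E] {u : ℕ → E} {l : E}
    (h : Tendsto u atTop (𝓝 l)) : ∃ M : ℝ, ∀ n, ‖u n‖ ≤ M := by
  obtain ⟨M, hM⟩ := h.norm.bddAbove_range
  exact ⟨M, fun n => hM ⟨n, rfl⟩⟩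

theorem tendsto_tsum_of_dominated_of_tendsto_zero {β E : Type*} [NormedAddCommGroup E]
    [CompleteSpace E] {f : ℕ → β → E} {bound : β → ℝ} (hb : Summable bound)
    (hf : ∀ n b, ‖f n b‖ ≤ bound b) (i : β) {c : E} (hi : Tendsto (f · i) atTop (𝓝 c))
    (h0 : ∀ b ≠ i, Tendsto (f · b) atTop (𝓝 0)) :
    Tendsto (fun n => ∑' b, f n b) atTop (𝓝 c) := by
  classical
  rw [← tsum_pi_single i c]
  refine tendsto_tsum_of_dominated_convergence hb (fun b => ?_) (Eventually.of_forall hf)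
  obtain rfl | hbi := eq_or_ne b i
  · simpa only [Pi.single_eq_same] using hi
  · simpa only [Pi.single_eq_of_ne hbi] using h0 b hbi

section Triangular

/-- The triangular numbers `n (n + 1) / 2`, extended to the integers: the exponents of `q` in theta
series. -/
def tri (n : ℤ) : ℤ := n * (n + 1) / 2

theorem two_mul_tri (n : ℤ) : 2 * tri n = n * (n + 1) :=
  Int.mul_ediv_cancel' (Int.even_mul_succ_self n).two_dvd

theorem tri_zero : tri 0 = 0 := rfl

theorem tri_one : tri 1 = 1 := rfl

theorem tri_add (m n : ℤ) : tri (m + n) = tri m + tri n + m * n := by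
  linarith [two_mul_tri (m + n), two_mul_tri m, two_mul_tri n]

theorem tri_neg (n : ℤ) : tri (-n) = tri n - n := by
  linarith [two_mul_tri (-n), two_mul_tri n]

theorem zpow_tri_natCast_succ_mul_zpow (hq0 : q ≠ 0) (hx : x ≠ 0) (n : ℕ) :
    q ^ tri ((n + 1 : ℕ) : ℤ) * x ^ ((n + 1 : ℕ) : ℤ) =
      q ^ n * (q * x) * (q ^ tri n * x ^ (n : ℤ)) := by
  simp only [Nat.cast_add, Nat.cast_one, tri_add, tri_one, mul_one, zpow_add₀ hq0, zpow_add₀ hx,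
    zpow_natCast, zpow_one]
  ring

theorem summable_zpow_tri_mul_zpow_natCast (hq1 : ‖q‖ < 1) (hq0 : q ≠ 0) (hx : x ≠ 0) :
    Summable fun n : ℕ => q ^ tri n * x ^ (n : ℤ) := by
  have hne : ∀ n : ℕ, q ^ tri n * x ^ (n : ℤ) ≠ 0 := fun n =>
    mul_ne_zero (zpow_ne_zero _ hq0) (zpow_ne_zero _ hx)
  refine summable_of_ratio_test_tendsto_lt_one one_pos (Eventually.of_forall hne) ?_
  have hratio : ∀ n : ℕ, ‖q ^ tri ((n + 1 : ℕ) : ℤ) * x ^ ((n + 1 : ℕ) : ℤ)‖ /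
      ‖q ^ tri n * x ^ (n : ℤ)‖ = ‖q ^ n * (q * x)‖ := fun n => by
    rw [zpow_tri_natCast_succ_mul_zpow hq0 hx, norm_mul,
      mul_div_cancel_right₀ _ (norm_ne_zero_iff.2 (hne n))]
  simp_rw [hratio]
  simpa only [zero_mul, norm_zero] using
    ((tendsto_pow_atTop_nhds_zero_of_norm_lt_one hq1).mul_const (q * x)).norm

theorem summable_zpow_tri_mul_zpow (hq1 : ‖q‖ < 1) (hq0 : q ≠ 0) (hx : x ≠ 0) :
    Summable fun n : ℤ => q ^ tri n * x ^ n := by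
  refine .of_nat_of_neg (summable_zpow_tri_mul_zpow_natCast hq1 hq0 hx) ?_
  refine (summable_zpow_tri_mul_zpow_natCast hq1 hq0
    (inv_ne_zero (mul_ne_zero hq0 hx))).congr fun n => ?_
  rw [tri_neg, zpow_sub₀ hq0, inv_zpow, mul_zpow, zpow_neg]
  field_simp

end Triangular

section Pochhammer

theorem qPoch_zero (x q : ℂ) : qPoch x q 0 = 1 := rfl

theorem qPoch_succ (x q : ℂ) (n : ℕ) : qPoch x q (n + 1) = qPoch x q n * (1 - q ^ n * x) :=
  Finset.prod_range_succ _ _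

theorem qPoch_succ' (x q : ℂ) (n : ℕ) : qPoch x q (n + 1) = (1 - x) * qPoch (q * x) q n := by
  simp only [qPoch, Finset.prod_range_succ', pow_zero, one_mul, pow_succ, mul_assoc]
  exact mul_comm _ _

theorem tendsto_qPoch (hq1 : ‖q‖ < 1) (x : ℂ) :
    Tendsto (qPoch x q) atTop (𝓝 (qPochInf x q)) :=
  (multipliable_qPochInf x q hq1).hasProd.tendsto_prod_nat

theorem qPoch_ne_zero (h : ∀ i : ℕ, q ^ i * x ≠ 1) (n : ℕ) : qPoch x q n ≠ 0 :=
  Finset.prod_ne_zero_iff.2 fun i _ => sub_ne_zero.2 (h i).symm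

theorem qPochInf_ne_zero (hq1 : ‖q‖ < 1) (h : ∀ i : ℕ, q ^ i * x ≠ 1) : qPochInf x q ≠ 0 := by
  have hsum : Summable fun i : ℕ => ‖-(q ^ i * x)‖ := by
    simpa only [norm_neg, norm_mul, norm_pow] using
      (summable_geometric_of_lt_one (norm_nonneg q) hq1).mul_right ‖x‖
  have hne : ∀ i : ℕ, 1 + -(q ^ i * x) ≠ 0 := fun i => by
    simpa only [← sub_eq_add_neg] using sub_ne_zero.2 (h i).symm
  simpa only [qPochInf, sub_eq_add_neg] using tprod_one_add_ne_zero_of_summable hne hsum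

theorem qPochInf_eq_one_sub_mul (hq1 : ‖q‖ < 1) (x : ℂ) :
    qPochInf x q = (1 - x) * qPochInf (q * x) q := by
  refine tendsto_nhds_unique ((tendsto_qPoch hq1 x).comp (tendsto_add_atTop_nat 1)) ?_
  exact ((tendsto_qPoch hq1 (q * x)).const_mul (1 - x)).congr fun n => (qPoch_succ' x q n).symm

theorem qPoch_self_ne_zero (hq1 : ‖q‖ < 1) (n : ℕ) : qPoch q q n ≠ 0 :=
  qPoch_ne_zero (pow_mul_self_ne_one hq1) n

theorem qPochInf_self_ne_zero (hq1 : ‖q‖ < 1) : qPochInf q q ≠ 0 :=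
  qPochInf_ne_zero hq1 (pow_mul_self_ne_one hq1)

theorem qPoch_mul (x q : ℂ) (m n : ℕ) :
    qPoch x q (m * n) = ∏ j ∈ Finset.range m, qPoch (q ^ j * x) (q ^ m) n := by
  induction n with
  | zero => simp only [mul_zero, qPoch_zero, Finset.prod_const_one]
  | succ n ih =>
    simp_rw [qPoch_succ, Finset.prod_mul_distrib, ← ih]
    rw [mul_add_one, qPoch, Finset.prod_range_add, qPoch]
    simp only [pow_add, pow_mul, mul_assoc]

theorem qPochInf_eq_prod (hq1 : ‖q‖ < 1) (x : ℂ) {m : ℕ} (hm : m ≠ 0) :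
    qPochInf x q = ∏ j ∈ Finset.range m, qPochInf (q ^ j * x) (q ^ m) := by
  refine tendsto_nhds_unique
    ((tendsto_qPoch hq1 x).comp (tendsto_id.const_mul_atTop' hm.bot_lt)) ?_
  refine (tendsto_finsetProd _ fun j _ =>
    tendsto_qPoch (norm_pow_lt_one hq1 hm) (q ^ j * x)).congr fun n => ?_
  exact (qPoch_mul x q m n).symm

theorem qPoch_mul_qPoch_neg (x q : ℂ) (n : ℕ) :
    qPoch x q n * qPoch (-x) q n = qPoch (x ^ 2) (q ^ 2) n := by
  simp only [qPoch, ← Finset.prod_mul_distrib]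
  exact Finset.prod_congr rfl fun i _ => by ring

theorem qPochInf_mul_qPochInf_neg (hq1 : ‖q‖ < 1) (x : ℂ) :
    qPochInf x q * qPochInf (-x) q = qPochInf (x ^ 2) (q ^ 2) := by
  refine tendsto_nhds_unique ((tendsto_qPoch hq1 x).mul (tendsto_qPoch hq1 (-x))) ?_
  exact (tendsto_qPoch (norm_pow_lt_one hq1 two_ne_zero) (x ^ 2)).congr fun n =>
    (qPoch_mul_qPoch_neg x q n).symm

end Pochhammer

section QFactorial

/-- The reciprocal `1 / (q; q)_n`, extended by zero to negative `n` so that sums over `n` can be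
shifted freely. -/
noncomputable def qFacInv (q : ℂ) (n : ℤ) : ℂ := if n < 0 then 0 else (qPoch q q n.toNat)⁻¹

theorem qFacInv_of_neg (q : ℂ) {n : ℤ} (h : n < 0) : qFacInv q n = 0 := if_pos h

theorem qFacInv_natCast (q : ℂ) (n : ℕ) : qFacInv q n = (qPoch q q n)⁻¹ :=
  if_neg (Int.natCast_nonneg n).not_gt

theorem qFacInv_zero (q : ℂ) : qFacInv q 0 = 1 := by
  rw [← Nat.cast_zero, qFacInv_natCast, qPoch_zero, inv_one]

theorem qFacInv_sub_one (hq1 : ‖q‖ < 1) (n : ℤ) :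
    qFacInv q (n - 1) = (1 - q ^ n) * qFacInv q n := by
  rcases lt_trichotomy n 0 with h | rfl | h
  · rw [qFacInv_of_neg q h, qFacInv_of_neg q (by lia), mul_zero]
  · rw [zpow_zero, sub_self, zero_mul, qFacInv_of_neg q (by lia)]
  · obtain ⟨m, rfl⟩ : ∃ m : ℕ, n = (m + 1 : ℕ) := ⟨(n - 1).toNat, by lia⟩
    have hne := qPoch_self_ne_zero hq1 (m + 1)
    rw [Nat.cast_add_one, add_sub_cancel_right, ← Nat.cast_add_one, qFacInv_natCast,
      qFacInv_natCast, zpow_natCast, pow_succ, inv_eq_iff_eq_inv, mul_inv, inv_inv]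
    rw [qPoch_succ] at hne ⊢
    field_simp [right_ne_zero_of_mul hne]

theorem tendsto_qFacInv (hq1 : ‖q‖ < 1) :
    Tendsto (fun n : ℕ => qFacInv q n) atTop (𝓝 (qPochInf q q)⁻¹) := by
  simp_rw [qFacInv_natCast]
  exact (tendsto_qPoch hq1 q).inv₀ (qPochInf_self_ne_zero hq1)

theorem exists_norm_qFacInv_le (hq1 : ‖q‖ < 1) : ∃ M : ℝ, ∀ n, ‖qFacInv q n‖ ≤ M := by
  obtain ⟨M, hM⟩ := exists_norm_le_of_tendsto (tendsto_qFacInv hq1)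
  refine ⟨M, fun n => ?_⟩
  rcases lt_or_ge n 0 with h | h
  · rw [qFacInv_of_neg q h, norm_zero]
    exact (norm_nonneg _).trans (hM 0)
  · lift n to ℕ using h
    exact hM n

theorem tendsto_zpow_pow_zero (hq1 : ‖q‖ < 1) {a : ℤ} (ha : 0 < a) :
    Tendsto (fun n : ℕ => (q ^ a) ^ n) atTop (𝓝 0) := by
  lift a to ℕ using ha.le
  rw [zpow_natCast]
  exact tendsto_pow_atTop_nhds_zero_of_norm_lt_one (norm_pow_lt_one hq1 (by lia))

theorem norm_zpow_pow_le_one (hq1 : ‖q‖ < 1) {a : ℤ} (ha : 0 ≤ a) (n : ℕ) :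
    ‖(q ^ a) ^ n‖ ≤ 1 := by
  lift a to ℕ using ha
  rw [zpow_natCast, norm_pow, norm_pow]
  exact pow_le_one₀ (by positivity) (pow_le_one₀ (norm_nonneg q) hq1.le)

end QFactorial

section Euler

/-- The general term of Euler's expansion of `(-q y; q)_∞`, as a series over the integers whose
negative terms vanish. -/
noncomputable def eulerTerm (q y : ℂ) (a : ℤ) : ℂ := q ^ tri a * y ^ a * qFacInv q a

theorem summable_eulerTerm (hq1 : ‖q‖ < 1) (hq0 : q ≠ 0) {y : ℂ} (hy : y ≠ 0) :
    Summable (eulerTerm q y) := by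
  obtain ⟨M, hM⟩ := exists_norm_qFacInv_le hq1
  refine .of_norm_bounded ((summable_zpow_tri_mul_zpow hq1 hq0 hy).norm.mul_right M) fun a => ?_
  rw [eulerTerm, norm_mul]
  exact mul_le_mul_of_nonneg_left (hM a) (norm_nonneg _)

theorem eulerTerm_pow_mul (q y : ℂ) (n : ℕ) (a : ℤ) :
    eulerTerm q (q ^ n * y) a = (q ^ a) ^ n * eulerTerm q y a := by
  have hcomm : (q ^ n) ^ a = (q ^ a) ^ n := by
    simpa only [zpow_natCast] using zpow_comm q (n : ℤ) a
  rw [eulerTerm, mul_zpow, hcomm, eulerTerm]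
  ring

theorem eulerTerm_succ_sub (hq1 : ‖q‖ < 1) (hq0 : q ≠ 0) {y : ℂ} (hy : y ≠ 0) (a : ℤ) :
    eulerTerm q y (a + 1) - eulerTerm q (q * y) (a + 1) = q * y * eulerTerm q (q * y) a := by
  have hfac := qFacInv_sub_one hq1 (a + 1)
  simp only [add_sub_cancel_right, zpow_add₀ hq0, zpow_one] at hfac
  simp only [eulerTerm, tri_add, tri_one, mul_one, mul_zpow, zpow_add₀ hq0, zpow_add₀ hy, zpow_one,
    hfac]
  ring

theorem tsum_eulerTerm_eq_mul (hq1 : ‖q‖ < 1) (hq0 : q ≠ 0) {y : ℂ} (hy : y ≠ 0) :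
    ∑' a, eulerTerm q y a = (1 + q * y) * ∑' a, eulerTerm q (q * y) a := by
  have hshift := (Equiv.addRight (1 : ℤ)).tsum_eq fun a => eulerTerm q y a - eulerTerm q (q * y) a
  simp only [Equiv.coe_addRight, eulerTerm_succ_sub hq1 hq0 hy, tsum_mul_left] at hshift
  rw [(summable_eulerTerm hq1 hq0 hy).tsum_sub
    (summable_eulerTerm hq1 hq0 (mul_ne_zero hq0 hy))] at hshift
  linear_combination -hshift

theorem qPoch_mul_tsum_eulerTerm (hq1 : ‖q‖ < 1) (hq0 : q ≠ 0) {y : ℂ} (hy : y ≠ 0) (n : ℕ) :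
    qPoch (-(q * y)) q n * ∑' a, eulerTerm q (q ^ n * y) a = ∑' a, eulerTerm q y a := by
  induction n with
  | zero => simp only [qPoch_zero, pow_zero, one_mul]
  | succ n ih =>
    rw [← ih, tsum_eulerTerm_eq_mul hq1 hq0 (mul_ne_zero (pow_ne_zero n hq0) hy), qPoch_succ,
      pow_succ', mul_assoc q]
    ring

theorem tendsto_tsum_eulerTerm_pow_mul (hq1 : ‖q‖ < 1) (hq0 : q ≠ 0) {y : ℂ} (hy : y ≠ 0) :
    Tendsto (fun n : ℕ => ∑' a, eulerTerm q (q ^ n * y) a) atTop (𝓝 1) := by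
  refine tendsto_tsum_of_dominated_of_tendsto_zero (summable_eulerTerm hq1 hq0 hy).norm
    (fun n a => ?_) 0 ?_ fun a ha => ?_
  · rcases lt_or_ge a 0 with h | h
    · simp only [eulerTerm, qFacInv_of_neg q h, mul_zero, le_refl]
    · rw [eulerTerm_pow_mul, norm_mul]
      exact mul_le_of_le_one_left (norm_nonneg _) (norm_zpow_pow_le_one hq1 h n)
  · simp only [eulerTerm, tri_zero, zpow_zero, qFacInv_zero, mul_one, tendsto_const_nhds]
  · rcases ha.lt_or_gt with h | h
    · simp only [eulerTerm, qFacInv_of_neg q h, mul_zero, tendsto_const_nhds]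
    · simp_rw [eulerTerm_pow_mul]
      simpa only [zero_mul] using (tendsto_zpow_pow_zero hq1 h).mul_const (eulerTerm q y a)

theorem hasSum_eulerTerm (hq1 : ‖q‖ < 1) (hq0 : q ≠ 0) {y : ℂ} (hy : y ≠ 0) :
    HasSum (eulerTerm q y) (qPochInf (-(q * y)) q) := by
  have hlim := (tendsto_qPoch hq1 (-(q * y))).mul (tendsto_tsum_eulerTerm_pow_mul hq1 hq0 hy)
  simp_rw [qPoch_mul_tsum_eulerTerm hq1 hq0 hy, mul_one] at hlim
  rw [tendsto_nhds_unique hlim tendsto_const_nhds]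
  exact (summable_eulerTerm hq1 hq0 hy).hasSum

end Euler

section Durfee

/-- The general term of the Durfee rectangle series
`∑_b q^{b² + kb} / ((q; q)_b (q; q)_{b+k}) = 1 / (q; q)_∞`. -/
noncomputable def durfeeTerm (q : ℂ) (k b : ℤ) : ℂ :=
  q ^ (b * b + k * b) * qFacInv q b * qFacInv q (b + k)

theorem summable_zpow_sq_add_mul (hq1 : ‖q‖ < 1) (hq0 : q ≠ 0) (k : ℤ) :
    Summable fun b : ℤ => q ^ (b * b + k * b) := by
  refine (summable_zpow_tri_mul_zpow (norm_pow_lt_one hq1 two_ne_zero) (pow_ne_zero 2 hq0)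
    (zpow_ne_zero (k - 1) hq0)).congr fun b => ?_
  rw [← zpow_natCast, ← zpow_mul, ← zpow_mul, ← zpow_add₀ hq0]
  congr 1
  push_cast
  linarith [two_mul_tri b]

theorem exists_norm_durfeeTerm_le (hq1 : ‖q‖ < 1) :
    ∃ M : ℝ, ∀ k b, ‖durfeeTerm q k b‖ ≤ ‖q ^ (b * b + k * b)‖ * M := by
  obtain ⟨M, hM⟩ := exists_norm_qFacInv_le hq1
  have hM0 : 0 ≤ M := (norm_nonneg _).trans (hM 0)
  refine ⟨M * M, fun k b => ?_⟩
  rw [durfeeTerm, mul_assoc, norm_mul, norm_mul]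
  gcongr
  exacts [hM b, hM (b + k)]

theorem summable_durfeeTerm (hq1 : ‖q‖ < 1) (hq0 : q ≠ 0) (k : ℤ) :
    Summable (durfeeTerm q k) := by
  obtain ⟨M, hM⟩ := exists_norm_durfeeTerm_le hq1
  exact .of_norm_bounded ((summable_zpow_sq_add_mul hq1 hq0 k).norm.mul_right M) (hM k)

theorem durfeeTerm_natCast (hq0 : q ≠ 0) (k : ℕ) (b : ℤ) :
    durfeeTerm q k b = (q ^ b) ^ k * (q ^ (b * b) * qFacInv q b) * qFacInv q (b + k) := by
  rw [durfeeTerm, zpow_add₀ hq0, mul_comm (k : ℤ), zpow_mul q b k, zpow_natCast]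
  ring

theorem exists_norm_durfeeTerm_natCast_le (hq1 : ‖q‖ < 1) (hq0 : q ≠ 0) :
    ∃ M : ℝ, ∀ (k : ℕ) b, ‖durfeeTerm q k b‖ ≤ ‖q ^ (b * b + 0 * b) * qFacInv q b‖ * M := by
  obtain ⟨M, hM⟩ := exists_norm_qFacInv_le hq1
  refine ⟨M, fun k b => ?_⟩
  rcases lt_or_ge b 0 with h | h
  · simp only [durfeeTerm, qFacInv_of_neg q h, mul_zero, zero_mul, norm_zero, le_refl]
  · rw [durfeeTerm_natCast hq0, norm_mul, norm_mul, zero_mul, add_zero]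
    gcongr
    exacts [mul_le_of_le_one_left (norm_nonneg _) (norm_zpow_pow_le_one hq1 h k), hM _]

theorem durfeeTerm_sub (hq1 : ‖q‖ < 1) (hq0 : q ≠ 0) (k b : ℤ) :
    durfeeTerm q k b - durfeeTerm q (k + 1) b =
      q ^ (k + 1) * durfeeTerm q (k + 1 + 1) (b - 1) - q ^ (k + 1) * durfeeTerm q (k + 1) b := by
  have hfac := qFacInv_sub_one hq1 (b + (k + 1))
  rw [show b + (k + 1) - 1 = b + k by ring] at hfac
  simp only [durfeeTerm]
  rw [qFacInv_sub_one hq1 b, hfac, show b - 1 + (k + 1 + 1) = b + (k + 1) by ring,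
    show (b - 1) * (b - 1) + (k + 1 + 1) * (b - 1) = (b * b + k * b) - (k + 1) by ring,
    show b * b + (k + 1) * b = (b * b + k * b) + b by ring,
    zpow_sub₀ hq0 (b * b + k * b), zpow_add₀ hq0 (b * b + k * b), zpow_add₀ hq0 b]
  field_simp [zpow_ne_zero (k + 1) hq0]
  ring

theorem tsum_durfeeTerm_sub (hq1 : ‖q‖ < 1) (hq0 : q ≠ 0) (k : ℤ) :
    ∑' b, durfeeTerm q k b - ∑' b, durfeeTerm q (k + 1) b =
      -q ^ (k + 1) * (∑' b, durfeeTerm q (k + 1) b - ∑' b, durfeeTerm q (k + 1 + 1) b) := by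
  have hsum := summable_durfeeTerm hq1 hq0
  have hshift : HasSum (fun b => durfeeTerm q (k + 1 + 1) (b - 1))
      (∑' b, durfeeTerm q (k + 1 + 1) b) := by
    simpa only [Function.comp_def, Equiv.subRight_apply] using
      (Equiv.subRight (1 : ℤ)).hasSum_iff.2 (hsum (k + 1 + 1)).hasSum
  have hdiff := (hsum k).hasSum.sub (hsum (k + 1)).hasSum
  simp_rw [durfeeTerm_sub hq1 hq0] at hdiff
  rw [hdiff.unique ((hshift.mul_left _).sub ((hsum (k + 1)).hasSum.mul_left _))]
  ring

theorem tendsto_tsum_durfeeTerm (hq1 : ‖q‖ < 1) (hq0 : q ≠ 0) :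
    Tendsto (fun k : ℕ => ∑' b, durfeeTerm q k b) atTop (𝓝 (qPochInf q q)⁻¹) := by
  obtain ⟨M, hM⟩ := exists_norm_durfeeTerm_natCast_le hq1 hq0
  obtain ⟨N, hN⟩ := exists_norm_qFacInv_le hq1
  have hbound : Summable fun b : ℤ => ‖q ^ (b * b + 0 * b) * qFacInv q b‖ := by
    refine .of_nonneg_of_le (fun _ => norm_nonneg _) (fun b => ?_)
      ((summable_zpow_sq_add_mul hq1 hq0 0).norm.mul_right N)
    rw [norm_mul]
    exact mul_le_mul_of_nonneg_left (hN b) (norm_nonneg _)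
  refine tendsto_tsum_of_dominated_of_tendsto_zero (hbound.mul_right M) hM 0 ?_ fun b hb => ?_
  · simpa only [durfeeTerm, mul_zero, add_zero, zpow_zero, qFacInv_zero, one_mul, zero_add] using
      tendsto_qFacInv hq1
  · rcases hb.lt_or_gt with h | h
    · simp only [durfeeTerm, qFacInv_of_neg q h, mul_zero, zero_mul, tendsto_const_nhds]
    · lift b to ℕ using h.le
      simp_rw [durfeeTerm_natCast hq0, ← Nat.cast_add, add_comm b]
      simpa only [zero_mul, Function.comp_def] using
        ((tendsto_zpow_pow_zero hq1 h).mul_const _).mul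
          ((tendsto_qFacInv hq1).comp (tendsto_add_atTop_nat b))

theorem eq_zero_of_eq_neg_zpow_mul (hq1 : ‖q‖ < 1) {d : ℤ → ℂ}
    (hrec : ∀ k, d k = -q ^ (k + 1) * d (k + 1))
    (hlim : Tendsto (fun n : ℕ => d n) atTop (𝓝 0)) (k : ℤ) : d k = 0 := by
  have hmono : Monotone fun n : ℕ => ‖d n‖ := monotone_nat_of_le_succ fun n => by
    rw [hrec n, norm_mul, norm_neg, ← Nat.cast_add_one, zpow_natCast]
    exact mul_le_of_le_one_left (norm_nonneg _) (norm_pow_lt_one hq1 n.succ_ne_zero).le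
  have hnat (n : ℕ) : d n = 0 :=
    norm_le_zero_iff.1 (hmono.ge_of_tendsto (by simpa only [norm_zero] using hlim.norm) n)
  induction k using Int.induction_on with
  | zero => exact hnat 0
  | succ n _ => exact hnat (n + 1)
  | pred n ih => rw [hrec, sub_add_cancel, ih, mul_zero]

theorem tsum_durfeeTerm_add_one (hq1 : ‖q‖ < 1) (hq0 : q ≠ 0) (k : ℤ) :
    ∑' b, durfeeTerm q (k + 1) b = ∑' b, durfeeTerm q k b := by
  have hlim := tendsto_tsum_durfeeTerm hq1 hq0
  have hdiff : Tendsto (fun n : ℕ => ∑' b, durfeeTerm q n b - ∑' b, durfeeTerm q (n + 1) b)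
      atTop (𝓝 0) := by
    simpa only [sub_self, Function.comp_def, Nat.cast_add_one] using
      hlim.sub (hlim.comp (tendsto_add_atTop_nat 1))
  exact (sub_eq_zero.1 (eq_zero_of_eq_neg_zpow_mul hq1 (tsum_durfeeTerm_sub hq1 hq0) hdiff k)).symm

theorem hasSum_durfeeTerm (hq1 : ‖q‖ < 1) (hq0 : q ≠ 0) (k : ℤ) :
    HasSum (durfeeTerm q k) (qPochInf q q)⁻¹ := by
  have hconst (j : ℤ) : ∑' b, durfeeTerm q j b = ∑' b, durfeeTerm q 0 b := by
    induction j using Int.induction_on with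
    | zero => rfl
    | succ n ih => rw [tsum_durfeeTerm_add_one hq1 hq0, ih]
    | pred n ih => rw [← tsum_durfeeTerm_add_one hq1 hq0, sub_add_cancel, ih]
  have hlim := tendsto_tsum_durfeeTerm hq1 hq0
  simp_rw [hconst] at hlim
  rw [tendsto_nhds_unique hlim tendsto_const_nhds, ← hconst k]
  exact (summable_durfeeTerm hq1 hq0 k).hasSum

end Durfee

section Theta

/-- The general term of the theta series `∑_k (-1)^k q^{k(k-1)/2} x^k` of the Jacobi triple product
identity. -/
noncomputable def thetaTerm (x q : ℂ) (k : ℤ) : ℂ := q ^ tri k * (-(x / q)) ^ k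

/-- The shear `(k, b) ↦ (b + k, b)` of `ℤ × ℤ`, which reindexes the product of two Laurent series
by the total exponent `k`. -/
def shearEquiv : ℤ × ℤ ≃ ℤ × ℤ where
  toFun z := (z.2 + z.1, z.2)
  invFun z := (z.1 - z.2, z.2)
  left_inv z := by simp
  right_inv z := by simp

theorem eulerTerm_mul_eulerTerm (hq0 : q ≠ 0) (hx : x ≠ 0) (k b : ℤ) :
    eulerTerm q (-(x / q)) (b + k) * eulerTerm q (-x⁻¹) b =
      thetaTerm x q k * durfeeTerm q k b := by
  have hpow : q ^ (b * b + k * b) = q ^ tri b * q ^ tri b * q ^ (b * k) * (q ^ b)⁻¹ := by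
    rw [← zpow_add₀ hq0, ← zpow_add₀ hq0, ← zpow_neg, ← zpow_add₀ hq0]
    congr 1
    linarith [two_mul_tri b]
  have hinv : (-(x / q)) ^ b * (-x⁻¹) ^ b = (q ^ b)⁻¹ := by
    rw [← mul_zpow, ← inv_zpow]
    congr 1
    field_simp
  simp only [eulerTerm, thetaTerm, durfeeTerm]
  rw [tri_add, zpow_add₀ hq0, zpow_add₀ hq0, zpow_add₀ (neg_ne_zero.2 (div_ne_zero hx hq0)), hpow,
    ← hinv]
  ring

theorem hasSum_thetaTerm (hq1 : ‖q‖ < 1) (hq0 : q ≠ 0) (hx : x ≠ 0) :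
    HasSum (thetaTerm x q) (theta x q) := by
  have hy : -(x / q) ≠ 0 := neg_ne_zero.2 (div_ne_zero hx hq0)
  have hz : -x⁻¹ ≠ 0 := neg_ne_zero.2 (inv_ne_zero hx)
  have hleft := hasSum_eulerTerm hq1 hq0 hy
  have hright := hasSum_eulerTerm hq1 hq0 hz
  rw [mul_neg, neg_neg, mul_div_cancel₀ x hq0] at hleft
  rw [mul_neg, neg_neg, ← div_eq_mul_inv] at hright
  have hprod := shearEquiv.hasSum_iff.2 (hleft.mul hright
    (summable_mul_of_summable_norm hleft.summable.norm hright.summable.norm))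
  have hfiber (k : ℤ) : HasSum (fun b => thetaTerm x q k * durfeeTerm q k b)
      (thetaTerm x q k * (qPochInf q q)⁻¹) :=
    (hasSum_durfeeTerm hq1 hq0 k).mul_left _
  simp_rw [← eulerTerm_mul_eulerTerm hq0 hx] at hfiber
  simpa only [theta, inv_mul_cancel_right₀ (qPochInf_self_ne_zero hq1)] using
    (hprod.prod_fiberwise hfiber).mul_right (qPochInf q q)

theorem theta_self_div (hq0 : q ≠ 0) (x : ℂ) : theta (q / x) q = theta x q := by
  rw [theta, div_div_cancel₀ hq0, mul_comm (qPochInf (q / x) q), theta]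

theorem theta_one (hq1 : ‖q‖ < 1) : theta 1 q = 0 := by
  rw [theta, qPochInf_eq_one_sub_mul hq1 1, sub_self, zero_mul, zero_mul, zero_mul]

theorem theta_self_mul (hq1 : ‖q‖ < 1) (hq0 : q ≠ 0) (hx : x ≠ 0) :
    theta (q * x) q = -x⁻¹ * theta x q := by
  rw [theta, theta, div_mul_cancel_left₀ hq0, qPochInf_eq_one_sub_mul hq1 x,
    qPochInf_eq_one_sub_mul hq1 x⁻¹, ← div_eq_mul_inv]
  field_simp
  ring

theorem hasSum_theta_mul_zpow (hq1 : ‖q‖ < 1) (hq0 : q ≠ 0) {c : ℂ} (hc : c ≠ 0) (a : ℤ) {m : ℕ}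
    (hm : m ≠ 0) :
    HasSum (fun n : ℤ => (-c) ^ n * q ^ (m * tri n + (a - m) * n)) (theta (c * q ^ a) (q ^ m)) := by
  refine (hasSum_thetaTerm (norm_pow_lt_one hq1 hm) (pow_ne_zero m hq0)
    (mul_ne_zero hc (zpow_ne_zero a hq0))).congr_fun fun n => ?_
  rw [thetaTerm, mul_div_assoc, ← zpow_natCast q m, ← zpow_sub₀ hq0, ← neg_mul, mul_zpow,
    ← zpow_mul, ← zpow_mul, zpow_add₀ hq0]
  ring

theorem hasSum_J (hq1 : ‖q‖ < 1) (hq0 : q ≠ 0) (a : ℤ) {m : ℕ} (hm : m ≠ 0) :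
    HasSum (fun n : ℤ => (-1) ^ n * q ^ (m * tri n + (a - m) * n)) (J a m q) := by
  simpa only [J, one_mul] using hasSum_theta_mul_zpow hq1 hq0 one_ne_zero a hm

theorem J_zero (hq1 : ‖q‖ < 1) {m : ℕ} (hm : m ≠ 0) : J 0 m q = 0 := by
  rw [J, zpow_zero, theta_one (norm_pow_lt_one hq1 hm)]

theorem J_sub (hq0 : q ≠ 0) (a : ℤ) (m : ℕ) : J (m - a) m q = J a m q := by
  rw [J, zpow_sub₀ hq0, zpow_natCast, theta_self_div (pow_ne_zero m hq0), J]

theorem J_one_three (hq1 : ‖q‖ < 1) (hq0 : q ≠ 0) : J 1 3 q = qPochInf q q := by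
  have hdiv : q ^ 3 / q = q * q := by field_simp
  rw [J, theta, zpow_one, hdiv, qPochInf_eq_prod hq1 q three_ne_zero]
  simp only [Finset.prod_range_succ, Finset.prod_range_zero, pow_zero, one_mul, pow_succ]

theorem Jsingle_eq_qPochInf (hq1 : ‖q‖ < 1) (hq0 : q ≠ 0) {m : ℕ} (hm : m ≠ 0) :
    Jsingle m q = qPochInf (q ^ m) (q ^ m) := by
  rw [← J_one_three (norm_pow_lt_one hq1 hm) (pow_ne_zero m hq0), Jsingle, J, J, ← pow_mul',
    zpow_one, zpow_natCast]

end Theta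

section NotPower

/-- `x` is not an integral power of `q`. -/
def NotPower (x q : ℂ) : Prop := ∀ n : ℤ, x * q ^ n ≠ 1

theorem NotPower.one_sub_ne_zero (h : NotPower x q) (n : ℤ) : 1 - x * q ^ n ≠ 0 :=
  sub_ne_zero.2 (h n).symm

theorem NotPower.self_mul (hq0 : q ≠ 0) (h : NotPower x q) : NotPower (q * x) q := fun n => by
  rw [mul_comm q, mul_assoc, ← zpow_one_add₀ hq0]
  exact h _

theorem NotPower.self_div (hq0 : q ≠ 0) (h : NotPower x q) : NotPower (q / x) q := fun n hn => by
  refine h (-(1 + n)) ?_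
  rw [zpow_neg, zpow_one_add₀ hq0, ← inv_inj, mul_inv, inv_inv, inv_one, ← hn]
  ring

theorem notPower_of_norm_eq (hq1 : ‖q‖ < 1) (hq0 : q ≠ 0) {j m : ℕ} (hx : ‖x‖ = ‖q‖ ^ j)
    (hjm : ¬ m ∣ j) : NotPower x (q ^ m) := fun n hn => by
  have hnorm := congrArg norm hn
  rw [norm_mul, hx, norm_zpow, norm_pow, norm_one, ← zpow_natCast, ← zpow_natCast, ← zpow_mul,
    ← zpow_add₀ (norm_ne_zero_iff.2 hq0), zpow_eq_one_iff_right₀ (norm_nonneg q) hq1.ne] at hnorm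
  exact hjm (Int.natCast_dvd_natCast.1 ⟨-n, by linarith⟩)

theorem qPochInf_eq_zero (i : ℕ) (h : q ^ i * x = 1) : qPochInf x q = 0 :=
  tprod_of_exists_eq_zero ⟨i, sub_eq_zero.2 h.symm⟩

theorem NotPower.qPochInf_ne_zero (hq1 : ‖q‖ < 1) (h : NotPower x q) : qPochInf x q ≠ 0 :=
  MockTheta.qPochInf_ne_zero hq1 fun i => by simpa only [mul_comm, zpow_natCast] using h i

theorem theta_ne_zero_iff (hq1 : ‖q‖ < 1) (hq0 : q ≠ 0) : theta x q ≠ 0 ↔ NotPower x q := by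
  refine ⟨fun h n hn => h ?_, fun h => mul_ne_zero (mul_ne_zero (h.qPochInf_ne_zero hq1)
    ((h.self_div hq0).qPochInf_ne_zero hq1)) (qPochInf_self_ne_zero hq1)⟩
  rcases lt_or_ge n 0 with hneg | hnonneg
  · obtain ⟨m, rfl⟩ : ∃ m : ℕ, n = -(m + 1 : ℕ) := ⟨(-n - 1).toNat, by lia⟩
    have hm : q ^ m * (q / x) = 1 := by
      rw [zpow_neg, zpow_natCast, ← div_eq_mul_inv, div_eq_one_iff_eq (pow_ne_zero _ hq0)] at hn
      rw [← mul_div_assoc, ← pow_succ, hn, div_self (pow_ne_zero _ hq0)]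
    rw [theta, qPochInf_eq_zero m hm, mul_zero, zero_mul]
  · lift n to ℕ using hnonneg
    rw [zpow_natCast, mul_comm] at hn
    rw [theta, qPochInf_eq_zero n hn, zero_mul, zero_mul]

end NotPower

section Reciprocals

theorem eventually_half_le_norm_one_sub_mul_zpow (hq1 : ‖q‖ < 1) (hq0 : q ≠ 0) {K : Set ℂ}
    (hK : IsCompact K) (hK0 : 0 ∉ K) :
    ∀ᶠ n : ℤ in cofinite, ∀ x ∈ K, 1 / 2 ≤ ‖1 - x * q ^ n‖ := by
  obtain ⟨r, hr0, hr⟩ := hK.exists_forall_le' continuous_norm.continuousOn fun x hx =>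
    norm_pos_iff.2 (ne_of_mem_of_not_mem hx hK0)
  obtain ⟨R, hR⟩ := hK.isBounded.exists_norm_le
  have hpow := tendsto_pow_atTop_nhds_zero_of_lt_one (norm_nonneg q) hq1
  have htop : ∀ᶠ n : ℕ in atTop, R * ‖q‖ ^ n < 1 / 2 :=
    (hpow.const_mul R).eventually_lt_const (by norm_num)
  have hbot : ∀ᶠ n : ℕ in atTop, 3 / 2 * ‖q‖ ^ n < r :=
    (hpow.const_mul (3 / 2)).eventually_lt_const (by simpa only [mul_zero] using hr0)
  rw [Int.cofinite_eq, eventually_sup]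
  constructor
  · refine (tendsto_neg_atBot_atTop.eventually
      (p := fun n : ℤ => ∀ x ∈ K, 1 / 2 ≤ ‖1 - x * q ^ (-n)‖) ?_).mono fun n hn => by
        simpa only [neg_neg] using hn
    rw [← Nat.map_cast_int_atTop, eventually_map]
    filter_upwards [hbot] with n hn x hxK
    have hlarge : 3 / 2 ≤ ‖x * q ^ (-(n : ℤ))‖ := by
      rw [norm_mul, zpow_neg, norm_inv, zpow_natCast, norm_pow, ← div_eq_mul_inv,
        le_div_iff₀ (pow_pos (norm_pos_iff.2 hq0) n)]
      exact hn.le.trans (hr x hxK)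
    have htri := norm_sub_norm_le (x * q ^ (-(n : ℤ))) 1
    rw [norm_sub_rev, norm_one] at htri
    linarith
  · rw [← Nat.map_cast_int_atTop, eventually_map]
    filter_upwards [htop] with n hn x hxK
    have hsmall : ‖x * q ^ (n : ℤ)‖ ≤ 1 / 2 := by
      rw [norm_mul, zpow_natCast, norm_pow]
      exact (mul_le_mul_of_nonneg_right (hR x hxK) (by positivity)).trans hn.le
    have htri := norm_sub_norm_le 1 (x * q ^ (n : ℤ))
    rw [norm_one] at htri
    linarith

theorem exists_norm_one_sub_mul_zpow_inv_le (hq1 : ‖q‖ < 1) (hq0 : q ≠ 0) (hx : x ≠ 0) :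
    ∃ M : ℝ, ∀ n : ℤ, ‖(1 - x * q ^ n)⁻¹‖ ≤ M := by
  have hbdd : ∀ᶠ n : ℤ in cofinite, ‖(1 - x * q ^ n)⁻¹‖ ≤ 2 := by
    filter_upwards [eventually_half_le_norm_one_sub_mul_zpow hq1 hq0 isCompact_singleton hx.symm]
      with n hn
    rw [norm_inv]
    exact (inv_anti₀ one_half_pos (hn x rfl)).trans (by norm_num)
  obtain ⟨M, hM⟩ := (isBoundedUnder_of_eventually_le hbdd).bddAbove_range_of_cofinite
  exact ⟨M, fun n => hM ⟨n, rfl⟩⟩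

end Reciprocals

section PartialFractions

/-- The coefficient of `(1 - x q^k)⁻¹` in the partial fraction expansion of
`1 / ((x; q)_{n+1} (q/x; q)_n)`; it vanishes unless `|k| ≤ n`. -/
noncomputable def pfCoeff (q : ℂ) (n k : ℤ) : ℂ :=
  (-1) ^ k * q ^ tri k * (qFacInv q (n - k) * qFacInv q (n + k))

theorem summable_mul_qFacInv (q : ℂ) (m n : ℤ) (c : ℤ → ℂ) :
    Summable fun k => c k * (qFacInv q (m - k) * qFacInv q (n + k)) := by
  refine summable_of_hasFiniteSupport ((Set.finite_Icc (-n) m).subset fun k hk => ?_)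
  by_contra h
  rw [Set.mem_Icc, not_and_or, not_le, not_le] at h
  refine hk ?_
  rcases h with h | h
  · simp only [qFacInv_of_neg q (show n + k < 0 by lia), mul_zero]
  · simp only [qFacInv_of_neg q (show m - k < 0 by lia), zero_mul, mul_zero]

theorem pfCoeff_of_neg (q : ℂ) {n : ℤ} (hn : n < 0) (k : ℤ) : pfCoeff q n k = 0 := by
  rcases le_or_gt 0 k with h | h
  · rw [pfCoeff, qFacInv_of_neg q (show n - k < 0 by lia), zero_mul, mul_zero]
  · rw [pfCoeff, qFacInv_of_neg q (show n + k < 0 by lia), mul_zero, mul_zero]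

theorem neg_one_zpow_neg (k : ℤ) : (-1 : ℂ) ^ (-k) = (-1) ^ k := by
  rw [zpow_neg, ← inv_zpow, inv_neg_one]

theorem pfCoeff_neg (hq0 : q ≠ 0) (n k : ℤ) : pfCoeff q n (-k) = (q ^ k)⁻¹ * pfCoeff q n k := by
  rw [pfCoeff, neg_one_zpow_neg, tri_neg, zpow_sub₀ hq0, sub_neg_eq_add, ← sub_eq_add_neg, pfCoeff]
  ring

theorem tsum_eq_zero_of_one_sub_eq_neg {f : ℤ → ℂ} (hf : ∀ k, f (1 - k) = -f k) :
    ∑' k, f k = 0 := by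
  have hrefl := (Equiv.subLeft (1 : ℤ)).tsum_eq f
  simp only [Equiv.subLeft_apply, hf, tsum_neg] at hrefl
  exact self_eq_neg.1 hrefl.symm

/-- With the bottom indices `N`, `N - 1` the terms cancel in pairs `k ↔ 1 - k`, and the symmetric
sum telescopes to this one. -/
theorem hasSum_neg_one_zpow_mul_qFacInv (q : ℂ) (N : ℤ) :
    HasSum (fun k : ℤ => (-1) ^ k * q ^ tri (k - 1) *
      (qFacInv q (N - k) * qFacInv q (N - 1 + k))) 0 := by
  have hsum := (summable_mul_qFacInv q N (N - 1) fun k => (-1) ^ k * q ^ tri (k - 1)).hasSum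
  rwa [tsum_eq_zero_of_one_sub_eq_neg fun k => ?_] at hsum
  have htri : tri (1 - k - 1) = tri (k - 1) := by
    linarith [two_mul_tri (1 - k - 1), two_mul_tri (k - 1)]
  rw [htri, sub_eq_add_neg 1 k, zpow_one_add₀ (by norm_num), neg_one_zpow_neg,
    show N - (1 + -k) = N - 1 + k by ring, show N - 1 + (1 + -k) = N - k by ring]
  ring

theorem one_sub_mul_pfCoeff (hq1 : ‖q‖ < 1) (hq0 : q ≠ 0) (N : ℕ) (k : ℤ) :
    (1 - q ^ (2 * N)) * pfCoeff q N k =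
      q ^ N * ((-1) ^ k * q ^ tri (k - 1) * (qFacInv q (N - k) * qFacInv q (N - 1 + k))) -
        (-1) ^ (k + 1) * q ^ tri (k + 1 - 1) *
          (qFacInv q (N - (k + 1)) * qFacInv q (N - 1 + (k + 1))) := by
  have htri : tri (k - 1) = tri k - k := by linarith [two_mul_tri k, two_mul_tri (k - 1)]
  rw [pfCoeff, htri, add_sub_cancel_right, show (N : ℤ) - (k + 1) = N - k - 1 by ring,
    show (N : ℤ) - 1 + (k + 1) = N + k by ring, show (N : ℤ) - 1 + k = N + k - 1 by ring,
    qFacInv_sub_one hq1 (N - k), qFacInv_sub_one hq1 (N + k),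
    zpow_add_one₀ (by norm_num : (-1 : ℂ) ≠ 0), zpow_sub₀ hq0, zpow_sub₀ hq0, zpow_add₀ hq0,
    zpow_natCast, pow_mul']
  field_simp [zpow_ne_zero k hq0]
  ring

theorem hasSum_pfCoeff (hq1 : ‖q‖ < 1) (hq0 : q ≠ 0) {N : ℕ} (hN : N ≠ 0) :
    HasSum (pfCoeff q N) 0 := by
  have hodd := hasSum_neg_one_zpow_mul_qFacInv q N
  have htel := (hodd.mul_left (q ^ N)).sub ((Equiv.addRight (1 : ℤ)).hasSum_iff.2 hodd)
  simp only [Function.comp_def, Equiv.coe_addRight, ← one_sub_mul_pfCoeff hq1 hq0, mul_zero,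
    sub_zero] at htel
  have hne : 1 - q ^ (2 * N) ≠ 0 := sub_ne_zero.2 fun h => by
    have hlt := norm_pow_lt_one hq1 (mul_ne_zero two_ne_zero hN)
    rw [← h, norm_one] at hlt
    exact hlt.false
  rw [← mul_zero (1 - q ^ (2 * N))] at htel
  exact (hasSum_mul_left_iff hne).1 htel

theorem hasSum_zpow_inv_mul_pfCoeff (hq1 : ‖q‖ < 1) (hq0 : q ≠ 0) {N : ℕ} (hN : N ≠ 0) :
    HasSum (fun k => (q ^ k)⁻¹ * pfCoeff q N k) 0 := by
  simpa only [Function.comp_def, Equiv.neg_apply, pfCoeff_neg hq0] using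
    (Equiv.neg ℤ).hasSum_iff.2 (hasSum_pfCoeff hq1 hq0 hN)

theorem gDenom_succ (x q : ℂ) (n : ℕ) :
    gDenom x q (n + 1) = gDenom x q n * ((1 - q ^ (n + 1) * x) * (1 - q ^ n * (q / x))) := by
  rw [gDenom, qPoch_succ, qPoch_succ (q / x), gDenom]
  ring

theorem pfCoeff_succ_mul (hq1 : ‖q‖ < 1) (hq0 : q ≠ 0) (hx : x ≠ 0) (h : NotPower x q) (n : ℕ)
    (k : ℤ) :
    pfCoeff q (n + 1 : ℕ) k * (1 - x * q ^ k)⁻¹ * ((1 - q ^ (n + 1) * x) * (1 - q ^ n * (q / x))) =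
      pfCoeff q n k * (1 - x * q ^ k)⁻¹ +
        (q ^ (n + 1) * ((q ^ k)⁻¹ * pfCoeff q (n + 1 : ℕ) k) -
          q ^ (n + 1) / x * pfCoeff q (n + 1 : ℕ) k) := by
  have hinv := inv_mul_cancel₀ (h.one_sub_ne_zero k)
  have hqk := zpow_ne_zero k hq0
  simp only [pfCoeff]
  rw [show (n : ℤ) - k = (n + 1 : ℕ) - k - 1 by push_cast; ring,
    show (n : ℤ) + k = (n + 1 : ℕ) + k - 1 by push_cast; ring, qFacInv_sub_one hq1,
    qFacInv_sub_one hq1, zpow_sub₀ hq0, zpow_add₀ hq0, zpow_natCast, pow_succ]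
  generalize (1 - x * q ^ k)⁻¹ = r at *
  generalize qFacInv q ((n + 1 : ℕ) - k) = u
  generalize qFacInv q ((n + 1 : ℕ) + k) = v
  generalize q ^ k = y at *
  field_simp
  linear_combination u * v * q ^ n * q * (x - y) * hinv

theorem NotPower.qPoch_ne_zero (h : NotPower x q) (n : ℕ) : qPoch x q n ≠ 0 :=
  MockTheta.qPoch_ne_zero (fun i => by simpa only [mul_comm, zpow_natCast] using h i) n

theorem gDenom_ne_zero (hq0 : q ≠ 0) (h : NotPower x q) (n : ℕ) : gDenom x q n ≠ 0 :=
  mul_ne_zero (h.qPoch_ne_zero (n + 1)) ((h.self_div hq0).qPoch_ne_zero n)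

theorem hasSum_pfCoeff_mul_inv (hq1 : ‖q‖ < 1) (hq0 : q ≠ 0) (hx : x ≠ 0) (h : NotPower x q)
    (n : ℕ) :
    HasSum (fun k => pfCoeff q n k * (1 - x * q ^ k)⁻¹) (gDenom x q n)⁻¹ := by
  induction n with
  | zero =>
    convert hasSum_single (0 : ℤ) fun k hk => ?_ using 1
    · simp [pfCoeff, tri_zero, qFacInv_zero, gDenom, qPoch]
    · rcases hk.lt_or_gt with h | h
      · simp [pfCoeff, qFacInv_of_neg q h]
      · simp [pfCoeff, qFacInv_of_neg q (neg_lt_zero.2 h)]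
  | succ n ih =>
    have hfac : (1 - q ^ (n + 1) * x) * (1 - q ^ n * (q / x)) ≠ 0 := fun h0 =>
      gDenom_ne_zero hq0 h (n + 1) (by rw [gDenom_succ, h0, mul_zero])
    have hvanish :=
      ((hasSum_zpow_inv_mul_pfCoeff hq1 hq0 n.succ_ne_zero).mul_left (q ^ (n + 1))).sub
        ((hasSum_pfCoeff hq1 hq0 n.succ_ne_zero).mul_left (q ^ (n + 1) / x))
    have hsum := (ih.add hvanish).congr_fun (pfCoeff_succ_mul hq1 hq0 hx h n)
    rw [mul_zero, mul_zero, sub_zero, add_zero] at hsum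
    rw [gDenom_succ, mul_inv, ← div_eq_mul_inv]
    exact (hsum.div_const _).congr_fun fun k => (mul_div_cancel_right₀ _ hfac).symm

end PartialFractions

section Appell

theorem summable_sq_mul_pfCoeff (hq1 : ‖q‖ < 1) (hq0 : q ≠ 0) (hx : x ≠ 0) :
    Summable fun z : ℕ × ℤ => q ^ z.1 ^ 2 * (pfCoeff q z.1 z.2 * (1 - x * q ^ z.2)⁻¹) := by
  obtain ⟨M, hM⟩ := exists_norm_qFacInv_le hq1
  obtain ⟨K, hK⟩ := exists_norm_one_sub_mul_zpow_inv_le hq1 hq0 hx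
  have hsq : Summable fun n : ℕ => ‖q ^ n ^ 2‖ :=
    (((summable_zpow_sq_add_mul hq1 hq0 0).comp_injective Nat.cast_injective).congr fun n => by
      simp only [Function.comp_apply, zero_mul, add_zero, sq, ← Nat.cast_mul, zpow_natCast]).norm
  have htri := (summable_zpow_tri_mul_zpow hq1 hq0 one_ne_zero).norm.mul_right (M * M * K)
  have hM0 := (norm_nonneg _).trans (hM 0)
  refine .of_norm_bounded (hsq.mul_of_nonneg htri (fun _ => norm_nonneg _) fun _ => ?_) fun z => ?_
  · have := (norm_nonneg _).trans (hK 0)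
    positivity
  · simp only [pfCoeff, norm_mul, one_zpow, norm_zpow, norm_neg, norm_one, one_mul, mul_one]
    rw [mul_assoc _ _ ‖(1 - x * q ^ z.2)⁻¹‖]
    gcongr
    exacts [hM _, hM _, hK _]

theorem zpow_sq_mul_pfCoeff (hq0 : q ≠ 0) (n k : ℤ) :
    q ^ (n * n) * pfCoeff q n k =
      (-1) ^ k * q ^ (3 * tri k - k) * durfeeTerm q (2 * k) (n - k) := by
  have hexp : q ^ (n * n) * q ^ tri k =
      q ^ (3 * tri k - k) * q ^ ((n - k) * (n - k) + 2 * k * (n - k)) := by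
    rw [← zpow_add₀ hq0, ← zpow_add₀ hq0]
    congr 1
    linarith [two_mul_tri k]
  rw [pfCoeff, durfeeTerm, show n - k + 2 * k = n + k by ring]
  linear_combination ((-1) ^ k * (qFacInv q (n - k) * qFacInv q (n + k))) * hexp

theorem hasSum_sq_mul_pfCoeff (hq1 : ‖q‖ < 1) (hq0 : q ≠ 0) (k : ℤ) :
    HasSum (fun n : ℕ => q ^ n ^ 2 * pfCoeff q n k)
      ((-1) ^ k * q ^ (3 * tri k - k) * (qPochInf q q)⁻¹) := by
  have hint : HasSum (fun n : ℤ => q ^ (n * n) * pfCoeff q n k)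
      ((-1) ^ k * q ^ (3 * tri k - k) * (qPochInf q q)⁻¹) :=
    (((Equiv.subRight k).hasSum_iff.2 (hasSum_durfeeTerm hq1 hq0 (2 * k))).mul_left _).congr_fun
      fun n => zpow_sq_mul_pfCoeff hq0 n k
  refine ((Nat.cast_injective.hasSum_iff fun n hn => ?_).2 hint).congr_fun fun n => ?_
  · have hneg : n < 0 := by
      by_contra! h
      exact hn ⟨n.toNat, Int.toNat_of_nonneg h⟩
    rw [pfCoeff_of_neg q hneg, mul_zero]
  · simp only [Function.comp_apply, sq, ← Nat.cast_mul, zpow_natCast]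

theorem hasSum_sq_div_gDenom (hq1 : ‖q‖ < 1) (hq0 : q ≠ 0) (hx : x ≠ 0) (h : NotPower x q) :
    HasSum (fun n : ℕ => q ^ n ^ 2 / gDenom x q n)
      (∑' k : ℤ, (-1) ^ k * q ^ (3 * tri k - k) * (qPochInf q q)⁻¹ * (1 - x * q ^ k)⁻¹) := by
  have htotal := (summable_sq_mul_pfCoeff hq1 hq0 hx).hasSum
  have hrows := htotal.prod_fiberwise fun n =>
    (hasSum_pfCoeff_mul_inv hq1 hq0 hx h n).mul_left (q ^ n ^ 2)
  have hcols := ((Equiv.prodComm ℤ ℕ).hasSum_iff.2 htotal).prod_fiberwise fun k =>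
    ((hasSum_sq_mul_pfCoeff hq1 hq0 k).mul_right (1 - x * q ^ k)⁻¹).congr_fun fun n =>
      (mul_assoc _ _ _).symm
  rw [hcols.tsum_eq]
  exact hrows

/-- The general term of the Appell–Lerch series attached to the universal mock theta function. -/
noncomputable def appellTerm (x q : ℂ) (n : ℤ) : ℂ :=
  (-1) ^ n * q ^ (3 * tri n) * (1 - x * q ^ n)⁻¹

/-- The Appell–Lerch series `∑ (-1)^n q^{3n(n+1)/2} / (1 - x q^n)`, which is `(q; q)_∞ g(x, q)`. -/
noncomputable def appell (x q : ℂ) : ℂ := ∑' n, appellTerm x q n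

theorem summable_zpow_three_mul_tri (hq1 : ‖q‖ < 1) (hq0 : q ≠ 0) :
    Summable fun n : ℤ => q ^ (3 * tri n) := by
  refine (summable_zpow_tri_mul_zpow (norm_pow_lt_one hq1 three_ne_zero) (pow_ne_zero 3 hq0)
    one_ne_zero).congr fun n => ?_
  rw [one_zpow, mul_one, zpow_mul]
  rfl

theorem hasSum_appellTerm (hq1 : ‖q‖ < 1) (hq0 : q ≠ 0) (hx : x ≠ 0) :
    HasSum (appellTerm x q) (appell x q) := by
  obtain ⟨K, hK⟩ := exists_norm_one_sub_mul_zpow_inv_le hq1 hq0 hx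
  refine (Summable.of_norm_bounded ((summable_zpow_three_mul_tri hq1 hq0).norm.mul_right K)
    fun n => ?_).hasSum
  rw [appellTerm, norm_mul, norm_mul, norm_zpow, norm_neg, norm_one, one_zpow, one_mul]
  exact mul_le_mul_of_nonneg_left (hK n) (norm_nonneg _)

theorem gDefined_of_notPower (hq1 : ‖q‖ < 1) (hq0 : q ≠ 0) (hx : x ≠ 0) (h : NotPower x q) :
    GDefined x q :=
  ⟨hx, gDenom_ne_zero hq0 h, (hasSum_sq_div_gDenom hq1 hq0 hx h).summable⟩

theorem J_two_three (hq1 : ‖q‖ < 1) (hq0 : q ≠ 0) : J 2 3 q = qPochInf q q := by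
  rw [← J_one_three hq1 hq0, ← J_sub hq0]
  rfl

theorem mul_appellTerm_add (hq0 : q ≠ 0) (h : NotPower x q) (n : ℤ) :
    x * appellTerm x q n + (-1) ^ n * q ^ ((3 : ℕ) * tri n + (2 - (3 : ℕ)) * n) =
      (-1) ^ n * q ^ (3 * tri n - n) * (1 - x * q ^ n)⁻¹ := by
  have hinv := inv_mul_cancel₀ (h.one_sub_ne_zero n)
  have hqn := zpow_ne_zero n hq0
  rw [show ((3 : ℕ) : ℤ) * tri n + (2 - (3 : ℕ)) * n = 3 * tri n - n by push_cast; ring, appellTerm,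
    zpow_sub₀ hq0]
  generalize (1 - x * q ^ n)⁻¹ = r at *
  field_simp
  linear_combination -hinv

theorem g_eq_appell (hq1 : ‖q‖ < 1) (hq0 : q ≠ 0) (hx : x ≠ 0) (h : NotPower x q) :
    g x q = appell x q * (qPochInf q q)⁻¹ := by
  have hJ := qPochInf_self_ne_zero hq1
  have hsum := (((hasSum_appellTerm hq1 hq0 hx).mul_left x).add
    (hasSum_J hq1 hq0 2 three_ne_zero)).mul_right (qPochInf q q)⁻¹
  rw [J_two_three hq1 hq0] at hsum
  have hg := (hasSum_sq_div_gDenom hq1 hq0 hx h).tsum_eq.trans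
    (hsum.congr_fun fun n => by rw [mul_appellTerm_add hq0 h, mul_right_comm]).tsum_eq
  rw [g, hg]
  field_simp
  ring

theorem appellTerm_self_mul_sub_one (hq0 : q ≠ 0) (h : NotPower x q) (n : ℤ) :
    appellTerm (q * x) q (n - 1) = -x ^ 3 * appellTerm x q n -
      ((-1) ^ n * q ^ ((3 : ℕ) * tri n + (0 - (3 : ℕ)) * n) +
        x * ((-1) ^ n * q ^ ((3 : ℕ) * tri n + (1 - (3 : ℕ)) * n)) +
        x ^ 2 * ((-1) ^ n * q ^ ((3 : ℕ) * tri n + (2 - (3 : ℕ)) * n))) := by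
  have hinv := inv_mul_cancel₀ (h.one_sub_ne_zero n)
  have hqn := zpow_ne_zero n hq0
  have hpole : q * x * q ^ (n - 1) = x * q ^ n := by
    rw [zpow_sub_one₀ hq0]
    field_simp
  have htri : 3 * tri (n - 1) = 3 * tri n - n - n - n := by
    linarith [two_mul_tri (n - 1), two_mul_tri n]
  rw [appellTerm, appellTerm, hpole, htri,
    show ((3 : ℕ) : ℤ) * tri n + (0 - (3 : ℕ)) * n = 3 * tri n - n - n - n by push_cast; ring,
    show ((3 : ℕ) : ℤ) * tri n + (1 - (3 : ℕ)) * n = 3 * tri n - n - n by push_cast; ring,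
    show ((3 : ℕ) : ℤ) * tri n + (2 - (3 : ℕ)) * n = 3 * tri n - n by push_cast; ring]
  simp only [zpow_sub₀ hq0, zpow_sub_one₀ (by norm_num : (-1 : ℂ) ≠ 0)]
  generalize (1 - x * q ^ n)⁻¹ = r at *
  field_simp
  linear_combination (-(1 + x * q ^ n + x ^ 2 * (q ^ n) ^ 2)) * hinv

theorem appell_self_mul (hq1 : ‖q‖ < 1) (hq0 : q ≠ 0) (hx : x ≠ 0) (h : NotPower x q) :
    appell (q * x) q = -x ^ 3 * appell x q - (x + x ^ 2) * qPochInf q q := by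
  have hJ (a : ℤ) := hasSum_J hq1 hq0 a three_ne_zero
  have hsum := ((hasSum_appellTerm hq1 hq0 hx).mul_left (-x ^ 3)).sub
    (((hJ 0).add ((hJ 1).mul_left x)).add ((hJ 2).mul_left (x ^ 2)))
  rw [J_zero hq1 three_ne_zero, J_one_three hq1 hq0, J_two_three hq1 hq0] at hsum
  have hshift := (Equiv.subRight (1 : ℤ)).hasSum_iff.2
    (hasSum_appellTerm hq1 hq0 (mul_ne_zero hq0 hx))
  rw [hshift.unique (hsum.congr_fun (appellTerm_self_mul_sub_one hq0 h))]
  ring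

theorem appellTerm_self_div_neg_one_sub (hq0 : q ≠ 0) (hx : x ≠ 0) (h : NotPower x q) (n : ℤ) :
    appellTerm (q / x) q (-1 - n) =
      appellTerm x q n - (-1) ^ n * q ^ ((3 : ℕ) * tri n + (3 - (3 : ℕ)) * n) := by
  have hpole := h.one_sub_ne_zero n
  have hqn := zpow_ne_zero n hq0
  have hrefl : 1 - q / x * q ^ (-1 - n) = -(1 - x * q ^ n) / (x * q ^ n) := by
    rw [zpow_sub₀ hq0, zpow_neg_one]
    field_simp
    ring
  have htri : tri (-1 - n) = tri n := by
    linarith [two_mul_tri (-1 - n), two_mul_tri n]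
  have hsign : (-1 : ℂ) ^ (-1 - n) = -(-1) ^ n := by
    rw [sub_eq_neg_add, zpow_add₀ (by norm_num), neg_one_zpow_neg, zpow_neg_one]
    norm_num
  rw [appellTerm, appellTerm, hrefl, htri, hsign, Nat.cast_ofNat, sub_self, zero_mul, add_zero]
  field_simp
  ring

theorem appell_self_div (hq1 : ‖q‖ < 1) (hq0 : q ≠ 0) (hx : x ≠ 0) (h : NotPower x q) :
    appell (q / x) q = appell x q := by
  have hsum := (hasSum_appellTerm hq1 hq0 hx).sub (hasSum_J hq1 hq0 3 three_ne_zero)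
  rw [← J_sub hq0, Nat.cast_ofNat, sub_self, J_zero hq1 three_ne_zero, sub_zero] at hsum
  have hrefl := (Equiv.subLeft (-1 : ℤ)).hasSum_iff.2
    (hasSum_appellTerm hq1 hq0 (div_ne_zero hq0 hx))
  exact hrefl.unique (hsum.congr_fun (appellTerm_self_div_neg_one_sub hq0 hx h))

theorem g_self_mul (hq1 : ‖q‖ < 1) (hq0 : q ≠ 0) (hx : x ≠ 0) (h : NotPower x q) :
    g (q * x) q = -x ^ 3 * g x q - (x + x ^ 2) := by
  rw [g_eq_appell hq1 hq0 (mul_ne_zero hq0 hx) (h.self_mul hq0), g_eq_appell hq1 hq0 hx h,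
    appell_self_mul hq1 hq0 hx h, sub_mul, mul_inv_cancel_right₀ (qPochInf_self_ne_zero hq1),
    mul_assoc]

theorem g_self_div (hq1 : ‖q‖ < 1) (hq0 : q ≠ 0) (hx : x ≠ 0) (h : NotPower x q) :
    g (q / x) q = g x q := by
  rw [g_eq_appell hq1 hq0 (div_ne_zero hq0 hx) (h.self_div hq0), g_eq_appell hq1 hq0 hx h,
    appell_self_div hq1 hq0 hx h]

end Appell

section ThetaCofactor

theorem differentiable_qPochInf (hq1 : ‖q‖ < 1) : Differentiable ℂ fun x => qPochInf x q := by
  intro a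
  have hball := Metric.isOpen_ball (x := (0 : ℂ)) (ε := ‖a‖ + 1)
  have hprod := Summable.hasProdLocallyUniformlyOn_nat_one_add
    (f := fun (n : ℕ) (x : ℂ) => -(q ^ n * x)) (u := fun n => ‖q‖ ^ n * (‖a‖ + 1)) hball
    ((summable_geometric_of_lt_one (norm_nonneg q) hq1).mul_right _)
    (.of_forall fun n x hx => by
      rw [norm_neg, norm_mul, norm_pow]
      gcongr
      exact (mem_ball_zero_iff.1 hx).le) fun n => by fun_prop
  have hdiff := hprod.differentiableOn (.of_forall fun s => by
    simpa only [Finset.prod_fn] using DifferentiableOn.finsetProd fun _ _ => by fun_prop) hball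
  simpa only [qPochInf, sub_eq_add_neg] using
    hdiff.differentiableAt (hball.mem_nhds (mem_ball_zero_iff.2 (lt_add_one _)))

/-- The theta function with its factor `1 - x` removed. -/
noncomputable def thetaCofactor (x q : ℂ) : ℂ :=
  qPochInf (q * x) q * qPochInf (q / x) q * qPochInf q q

theorem one_sub_mul_thetaCofactor (hq1 : ‖q‖ < 1) (x : ℂ) :
    (1 - x) * thetaCofactor x q = theta x q := by
  rw [theta, qPochInf_eq_one_sub_mul hq1 x, thetaCofactor]
  ring

theorem thetaCofactor_one (q : ℂ) : thetaCofactor 1 q = qPochInf q q ^ 3 := by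
  rw [thetaCofactor, mul_one, div_one]
  ring

theorem differentiableAt_thetaCofactor (hq1 : ‖q‖ < 1) (hx : x ≠ 0) :
    DifferentiableAt ℂ (fun x => thetaCofactor x q) x := by
  have h := differentiable_qPochInf hq1
  have hdiv : DifferentiableAt ℂ (fun x => q / x) x := by fun_prop (disch := exact hx)
  exact ((h.differentiableAt.comp x (by fun_prop)).mul (h.differentiableAt.comp x hdiv)).mul_const _

theorem differentiableAt_theta (hq1 : ‖q‖ < 1) (hx : x ≠ 0) :
    DifferentiableAt ℂ (fun x => theta x q) x := by
  simp only [← one_sub_mul_thetaCofactor hq1]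
  exact (by fun_prop : DifferentiableAt ℂ (fun x : ℂ => 1 - x) x).mul
    (differentiableAt_thetaCofactor hq1 hx)

theorem thetaTerm_mul_theta (hq1 : ‖q‖ < 1) (hq0 : q ≠ 0) (hx : x ≠ 0) (n : ℤ) :
    thetaTerm x q n * theta (x * q ^ n) q = theta x q := by
  have hshift := (Equiv.addRight n).hasSum_iff.2 (hasSum_thetaTerm hq1 hq0 hx)
  refine (((hasSum_thetaTerm hq1 hq0 (mul_ne_zero hx (zpow_ne_zero n hq0))).mul_left
    (thetaTerm x q n)).congr_fun fun k => ?_).unique hshift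
  have hc : -(x / q) ≠ 0 := neg_ne_zero.2 (div_ne_zero hx hq0)
  have hmul : -(x * q ^ n / q) = -(x / q) * q ^ n := by ring
  simp only [Function.comp_apply, Equiv.coe_addRight, thetaTerm, hmul, mul_zpow, ← zpow_mul,
    tri_add, mul_comm k n, zpow_add₀ hq0, zpow_add₀ hc]
  ring

/-- The term of index `n` of the Appell–Lerch series, multiplied by `θ(x; q)`; multiplication by
`θ` removes the pole at `x = q^{-n}`. -/
noncomputable def thetaAppellTerm (x q : ℂ) (n : ℤ) : ℂ :=
  (-1) ^ n * q ^ (3 * tri n) * (thetaTerm x q n * thetaCofactor (x * q ^ n) q)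

theorem one_sub_mul_thetaAppellTerm (hq1 : ‖q‖ < 1) (hq0 : q ≠ 0) (hx : x ≠ 0) (n : ℤ) :
    (1 - x * q ^ n) * thetaAppellTerm x q n = (-1) ^ n * q ^ (3 * tri n) * theta x q := by
  rw [thetaAppellTerm, ← thetaTerm_mul_theta hq1 hq0 hx n, ← one_sub_mul_thetaCofactor hq1]
  ring

/-- The product `θ(x; q) g(x, q)`, extended over its removable singularities at the powers
of `q`. -/
noncomputable def thetaG (x q : ℂ) : ℂ := (∑' n, thetaAppellTerm x q n) * (qPochInf q q)⁻¹

theorem thetaG_eq (hq1 : ‖q‖ < 1) (hq0 : q ≠ 0) (hx : x ≠ 0) (h : NotPower x q) :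
    thetaG x q = theta x q * g x q := by
  have hterm (n : ℤ) : thetaAppellTerm x q n = theta x q * appellTerm x q n := by
    have hpole := h.one_sub_ne_zero n
    refine mul_left_cancel₀ hpole ?_
    rw [one_sub_mul_thetaAppellTerm hq1 hq0 hx, appellTerm]
    field_simp
  rw [thetaG, ((hasSum_appellTerm hq1 hq0 hx).mul_left (theta x q)).congr_fun hterm |>.tsum_eq,
    g_eq_appell hq1 hq0 hx h, mul_assoc]

theorem thetaG_one (hq1 : ‖q‖ < 1) (hq0 : q ≠ 0) : thetaG 1 q = qPochInf q q ^ 2 := by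
  have hpower (n : ℤ) (hn : n ≠ 0) : 1 - 1 * q ^ n ≠ 0 := by
    rw [one_mul]
    refine sub_ne_zero.2 fun h => hn ?_
    have hnorm := congrArg norm h
    rw [norm_one, norm_zpow] at hnorm
    exact (zpow_eq_one_iff_right₀ (norm_nonneg q) hq1.ne).1 hnorm.symm
  have hzero : ∀ n ≠ 0, thetaAppellTerm 1 q n = 0 := fun n hn => by
    have hmul := one_sub_mul_thetaAppellTerm hq1 hq0 one_ne_zero n
    rw [theta_one hq1, mul_zero] at hmul
    exact (mul_eq_zero.1 hmul).resolve_left (hpower n hn)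
  have hJ := qPochInf_self_ne_zero hq1
  rw [thetaG, tsum_eq_single 0 hzero, thetaAppellTerm, thetaTerm, tri_zero, mul_zero, zpow_zero,
    zpow_zero, zpow_zero, mul_one, one_mul, one_mul, thetaCofactor_one]
  field_simp

theorem exists_norm_thetaAppellTerm_le (hq1 : ‖q‖ < 1) (hq0 : q ≠ 0) {K : Set ℂ}
    (hK : IsCompact K) (hK0 : 0 ∉ K) :
    ∃ M : ℝ, ∀ᶠ n : ℤ in cofinite, ∀ x ∈ K, ‖thetaAppellTerm x q n‖ ≤ ‖q ^ (3 * tri n)‖ * M := by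
  have hne : ∀ x ∈ K, x ≠ 0 := fun x hx => ne_of_mem_of_not_mem hx hK0
  obtain ⟨M, hM⟩ := hK.exists_bound_of_continuousOn fun x hx =>
    (differentiableAt_theta hq1 (hne x hx)).continuousAt.continuousWithinAt
  refine ⟨2 * M, ?_⟩
  filter_upwards [eventually_half_le_norm_one_sub_mul_zpow hq1 hq0 hK hK0] with n hn x hx
  have hmul := congrArg norm (one_sub_mul_thetaAppellTerm hq1 hq0 (hne x hx) n)
  rw [norm_mul, norm_mul, norm_mul, norm_zpow, norm_neg, norm_one, one_zpow, one_mul] at hmul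
  have hlower := mul_le_mul_of_nonneg_right (hn x hx) (norm_nonneg (thetaAppellTerm x q n))
  have hupper := mul_le_mul_of_nonneg_left (hM x hx) (norm_nonneg (q ^ (3 * tri n)))
  linarith

theorem differentiableOn_thetaG (hq1 : ‖q‖ < 1) (hq0 : q ≠ 0) :
    DifferentiableOn ℂ (fun x => thetaG x q) {0}ᶜ := by
  have hsum : SummableLocallyUniformlyOn (fun n x => thetaAppellTerm x q n) {0}ᶜ :=
    .of_locally_bounded_eventually isOpen_compl_singleton fun K hK0 hK => by
      obtain ⟨M, hM⟩ := exists_norm_thetaAppellTerm_le hq1 hq0 hK fun h => hK0 h rfl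
      exact ⟨_, (summable_zpow_three_mul_tri hq1 hq0).norm.mul_right M, hM⟩
  refine (hsum.differentiableOn isOpen_compl_singleton fun n x hx => ?_).mul_const _
  have hne := mul_ne_zero hx (zpow_ne_zero n hq0)
  have hterm : DifferentiableAt ℂ (fun x => thetaTerm x q n) x := by
    have hx0 : x ≠ 0 := hx
    unfold thetaTerm
    fun_prop (disch := first | exact Or.inl (neg_ne_zero.2 (div_ne_zero hx0 hq0)) | simp [hq0])
  have hcofactor : DifferentiableAt ℂ (fun x => thetaCofactor (x * q ^ n) q) x :=
    (differentiableAt_thetaCofactor hq1 hne).comp (f := fun x => x * q ^ n) x (by fun_prop)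
  exact (hterm.mul hcofactor).const_mul _

theorem countable_not_notPower (q : ℂ) : {x | ¬ NotPower x q}.Countable := by
  refine (Set.countable_range fun n : ℤ => q ^ n).mono fun x hx => ?_
  obtain ⟨n, hn⟩ := not_forall_not.1 hx
  exact ⟨-n, (zpow_neg q n).trans (eq_inv_of_mul_eq_one_left hn).symm⟩

theorem eq_of_eq_of_notPower {f₁ f₂ : ℂ → ℂ} (h₁ : ContinuousOn f₁ {0}ᶜ)
    (h₂ : ContinuousOn f₂ {0}ᶜ) (h : ∀ x ≠ 0, NotPower x q → f₁ x = f₂ x) (hx : x ≠ 0) :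
    f₁ x = f₂ x := by
  have hnhds : {0}ᶜ ∈ 𝓝 x := isOpen_compl_singleton.mem_nhds hx
  have hfreq : ∃ᶠ y in 𝓝 x, NotPower y q :=
    (mem_closure_iff_frequently.1 ((countable_not_notPower q).dense_compl ℂ x)).mono
      fun y hy => not_not.1 hy
  exact tendsto_nhds_unique_of_frequently_eq (h₁.continuousAt hnhds) (h₂.continuousAt hnhds)
    ((hfreq.and_eventually hnhds).mono fun y hy => h y hy.2 hy.1)

theorem thetaG_self_mul (hq1 : ‖q‖ < 1) (hq0 : q ≠ 0) (hx : x ≠ 0) :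
    thetaG (q * x) q = x ^ 2 * thetaG x q + (1 + x) * theta x q := by
  have hG := (differentiableOn_thetaG hq1 hq0).continuousOn
  refine eq_of_eq_of_notPower (q := q) (f₁ := fun x => thetaG (q * x) q)
    (f₂ := fun x => x ^ 2 * thetaG x q + (1 + x) * theta x q)
    (hG.comp (by fun_prop) fun x hx => mul_ne_zero hq0 hx)
    (((by fun_prop : ContinuousOn (fun x : ℂ => x ^ 2) _).mul hG).add
      ((by fun_prop : ContinuousOn (fun x : ℂ => 1 + x) _).mul fun x hx =>
        (differentiableAt_theta hq1 hx).continuousAt.continuousWithinAt)) (fun x hx h => ?_) hx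
  rw [thetaG_eq hq1 hq0 (mul_ne_zero hq0 hx) (h.self_mul hq0), thetaG_eq hq1 hq0 hx h,
    theta_self_mul hq1 hq0 hx, g_self_mul hq1 hq0 hx h]
  field_simp
  ring

end ThetaCofactor

section Elliptic

theorem zpow_mul_invariant (hq0 : q ≠ 0) {f : ℂ → ℂ} (hf : ∀ x ≠ 0, f (q * x) = f x) (hx : x ≠ 0)
    (n : ℤ) : f (q ^ n * x) = f x := by
  induction n using Int.induction_on with
  | zero => rw [zpow_zero, one_mul]
  | succ n ih =>
    rw [zpow_add_one₀ hq0, mul_comm _ q, mul_assoc, hf _ (mul_ne_zero (zpow_ne_zero _ hq0) hx), ih]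
  | pred n ih =>
    rw [← ih, ← hf _ (mul_ne_zero (zpow_ne_zero _ hq0) hx), ← mul_assoc, ← zpow_one_add₀ hq0,
      add_sub_cancel]

theorem exists_norm_zpow_mul_mem_Icc (hq1 : ‖q‖ < 1) (hq0 : q ≠ 0) (hx : x ≠ 0) :
    ∃ n : ℤ, ‖q ^ n * x‖ ∈ Set.Icc ‖q‖ 1 := by
  have hq := norm_pos_iff.2 hq0
  obtain ⟨n, hlo, hhi⟩ := exists_mem_Ioc_zpow (norm_pos_iff.2 hx) ((one_lt_inv₀ hq).2 hq1)
  have hqn := zpow_pos hq (n + 1)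
  rw [inv_zpow, inv_lt_iff_one_lt_mul₀ (zpow_pos hq n)] at hlo
  rw [inv_zpow, le_inv_comm₀ (norm_pos_iff.2 hx) hqn, ← one_div, le_div_iff₀ (norm_pos_iff.2 hx)]
    at hhi
  refine ⟨n + 1, ?_, ?_⟩
  · rw [norm_mul, norm_zpow, zpow_add_one₀ hq.ne']
    nlinarith
  · rwa [norm_mul, norm_zpow]

theorem eq_one_of_self_mul_eq (hq1 : ‖q‖ < 1) (hq0 : q ≠ 0) {f : ℂ → ℂ}
    (hf : DifferentiableOn ℂ f {0}ᶜ) (hper : ∀ x ≠ 0, f (q * x) = f x) (hx : x ≠ 0) :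
    f x = f 1 := by
  have hdiff (y : ℂ) (hy : y ≠ 0) := hf.differentiableAt (isOpen_compl_singleton.mem_nhds hy)
  have hcompact : IsCompact (norm ⁻¹' Set.Icc ‖q‖ 1 : Set ℂ) :=
    (isCompact_closedBall (0 : ℂ) 1).of_isClosed_subset (isClosed_Icc.preimage continuous_norm)
      fun y hy => mem_closedBall_zero_iff.2 hy.2
  obtain ⟨M, hM⟩ := hcompact.exists_bound_of_continuousOn (f := f) fun y hy =>
    (hdiff y (norm_pos_iff.1 ((norm_pos_iff.2 hq0).trans_le hy.1))).continuousAt.continuousWithinAt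
  have hbound (y : ℂ) (hy : y ≠ 0) : ‖f y‖ ≤ M := by
    obtain ⟨n, hn⟩ := exists_norm_zpow_mul_mem_Icc hq1 hq0 hy
    rw [← zpow_mul_invariant hq0 hper hy n]
    exact hM _ hn
  have hentire : Differentiable ℂ fun w => f (Complex.exp w) := fun w =>
    (hdiff _ (Complex.exp_ne_zero w)).comp w Complex.differentiableAt_exp
  have hrange : Bornology.IsBounded (Set.range fun w => f (Complex.exp w)) :=
    isBounded_iff_forall_norm_le.2
      ⟨M, Set.forall_mem_range.2 fun w => hbound _ (Complex.exp_ne_zero w)⟩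
  simpa only [Complex.exp_log hx, Complex.exp_zero] using
    hentire.apply_eq_apply_of_bounded hrange (Complex.log x) 0

end Elliptic

section DuplicationRelation

/-- The combination of `g(x, q)`, `g(-q x², q⁴)` and `g(-q³ x², q⁴)` in the duplication relation,
multiplied by `θ(x; q) θ(-q x²; q⁴) θ(-q³ x²; q⁴)` so as to be holomorphic away from `0`. -/
noncomputable def duplication (x q : ℂ) : ℂ :=
  x * theta (-q * x ^ 2) (q ^ 4) * theta (-q ^ 3 * x ^ 2) (q ^ 4) * thetaG x q -
    q * (x ^ 2)⁻¹ * theta x q * theta (-q * x ^ 2) (q ^ 4) * thetaG (-q ^ 3 * x ^ 2) (q ^ 4) +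
    q * x * theta x q * theta (-q ^ 3 * x ^ 2) (q ^ 4) * thetaG (-q * x ^ 2) (q ^ 4) +
    theta x q * theta (-q * x ^ 2) (q ^ 4) * theta (-q ^ 3 * x ^ 2) (q ^ 4)

theorem duplication_self_mul (hq1 : ‖q‖ < 1) (hq0 : q ≠ 0) (hx : x ≠ 0) :
    duplication (q * x) q = duplication x q := by
  have hq4 := norm_pow_lt_one hq1 four_ne_zero
  have hq40 := pow_ne_zero 4 hq0
  have hy : -q * x ^ 2 ≠ 0 := mul_ne_zero (neg_ne_zero.2 hq0) (pow_ne_zero 2 hx)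
  have hmul₁ : -q * (q * x) ^ 2 = -q ^ 3 * x ^ 2 := by ring
  have hmul₃ : -q ^ 3 * (q * x) ^ 2 = q ^ 4 * (-q * x ^ 2) := by ring
  rw [duplication, duplication, hmul₁, hmul₃, theta_self_mul hq1 hq0 hx, theta_self_mul hq4 hq40 hy,
    thetaG_self_mul hq1 hq0 hx, thetaG_self_mul hq4 hq40 hy]
  field_simp
  ring

theorem differentiableOn_duplication (hq1 : ‖q‖ < 1) (hq0 : q ≠ 0) :
    DifferentiableOn ℂ (fun x => duplication x q) {0}ᶜ := by
  have hq4 := norm_pow_lt_one hq1 four_ne_zero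
  have hmaps {c : ℂ} (hc : c ≠ 0) : Set.MapsTo (fun x : ℂ => c * x ^ 2) {0}ᶜ {0}ᶜ :=
    fun x hx => mul_ne_zero hc (pow_ne_zero 2 hx)
  have hsq (c : ℂ) : DifferentiableOn ℂ (fun x : ℂ => c * x ^ 2) {0}ᶜ := by fun_prop
  have hq₁ : -q ≠ 0 := neg_ne_zero.2 hq0
  have hq₃ : -q ^ 3 ≠ 0 := neg_ne_zero.2 (pow_ne_zero 3 hq0)
  have hθ {p : ℂ} (hp : ‖p‖ < 1) : DifferentiableOn ℂ (fun x => theta x p) {0}ᶜ :=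
    fun x hx => (differentiableAt_theta hp hx).differentiableWithinAt
  have hG := differentiableOn_thetaG hq1 hq0
  have hG4 := differentiableOn_thetaG hq4 (pow_ne_zero 4 hq0)
  have hθ₁ := (hθ hq4).comp (hsq _) (hmaps hq₁)
  have hθ₃ := (hθ hq4).comp (hsq _) (hmaps hq₃)
  have hG₁ := hG4.comp (hsq _) (hmaps hq₁)
  have hG₃ := hG4.comp (hsq _) (hmaps hq₃)
  have hinv : DifferentiableOn ℂ (fun x : ℂ => q * (x ^ 2)⁻¹) {0}ᶜ := fun x hx => by
    have hx0 : x ^ 2 ≠ 0 := pow_ne_zero 2 hx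
    fun_prop (disch := exact hx0)
  exact (((((differentiableOn_id.mul hθ₁).mul hθ₃).mul hG).sub
    (((hinv.mul (hθ hq1)).mul hθ₁).mul hG₃)).add
    ((((differentiableOn_id.const_mul q).mul (hθ hq1)).mul hθ₃).mul hG₁)).add
    (((hθ hq1).mul hθ₁).mul hθ₃)

theorem duplication_eq (hq1 : ‖q‖ < 1) (hq0 : q ≠ 0) (hx : x ≠ 0) :
    duplication x q = theta (-q) (q ^ 4) ^ 2 * qPochInf q q ^ 2 := by
  have hrefl : theta (-q ^ 3) (q ^ 4) = theta (-q) (q ^ 4) := by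
    rw [← theta_self_div (pow_ne_zero 4 hq0)]
    congr 1
    field_simp
  rw [eq_one_of_self_mul_eq hq1 hq0 (differentiableOn_duplication hq1 hq0)
    (fun x => duplication_self_mul hq1 hq0) hx, duplication, theta_one hq1, thetaG_one hq1 hq0,
    one_pow, mul_one, mul_one, hrefl]
  ring

theorem mul_g_eq (hq1 : ‖q‖ < 1) (hq0 : q ≠ 0) (hx : x ≠ 0) (h : NotPower x q)
    (h₁ : NotPower (-q * x ^ 2) (q ^ 4)) (h₃ : NotPower (-q ^ 3 * x ^ 2) (q ^ 4)) :
    x * g x q = q * (x ^ 2)⁻¹ * g (-q ^ 3 * x ^ 2) (q ^ 4) - q * x * g (-q * x ^ 2) (q ^ 4) - 1 +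
      theta (-q) (q ^ 4) ^ 2 * qPochInf q q ^ 2 /
        (theta x q * theta (-q * x ^ 2) (q ^ 4) * theta (-q ^ 3 * x ^ 2) (q ^ 4)) := by
  have hq4 := norm_pow_lt_one hq1 four_ne_zero
  have hq40 := pow_ne_zero 4 hq0
  have hx2 := pow_ne_zero 2 hx
  have hθ := (theta_ne_zero_iff hq1 hq0).2 h
  have hθ₁ := (theta_ne_zero_iff hq4 hq40).2 h₁
  have hθ₃ := (theta_ne_zero_iff hq4 hq40).2 h₃
  have hrel := duplication_eq hq1 hq0 hx
  rw [duplication, thetaG_eq hq1 hq0 hx h,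
    thetaG_eq hq4 hq40 (mul_ne_zero (neg_ne_zero.2 hq0) hx2) h₁,
    thetaG_eq hq4 hq40 (mul_ne_zero (neg_ne_zero.2 (pow_ne_zero 3 hq0)) hx2) h₃] at hrel
  rw [← sub_eq_iff_eq_add', eq_div_iff (mul_ne_zero (mul_ne_zero hθ hθ₁) hθ₃), ← hrel]
  ring

end DuplicationRelation

section ThetaProducts

theorem qPochInf_mul_qPochInf_self_mul (hq1 : ‖q‖ < 1) (x : ℂ) :
    qPochInf x (q ^ 2) * qPochInf (q * x) (q ^ 2) = qPochInf x q := by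
  rw [qPochInf_eq_prod hq1 x two_ne_zero]
  simp only [Finset.prod_range_succ, Finset.prod_range_zero, pow_zero, pow_one, one_mul]

theorem theta_mul_theta_self_mul (hq1 : ‖q‖ < 1) (hq0 : q ≠ 0) (x : ℂ) :
    theta x (q ^ 2) * theta (q * x) (q ^ 2) * qPochInf q q =
      theta x q * qPochInf (q ^ 2) (q ^ 2) ^ 2 := by
  have hdiv : q ^ 2 / (q * x) = q / x := by rw [sq, mul_div_mul_left _ _ hq0]
  have hself : q * (q / x) = q ^ 2 / x := by ring
  rw [theta, theta, theta, hdiv, ← qPochInf_mul_qPochInf_self_mul hq1 x,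
    ← qPochInf_mul_qPochInf_self_mul hq1 (q / x), hself]
  ring

theorem theta_mul_theta_neg (hq1 : ‖q‖ < 1) (x : ℂ) :
    theta x q * theta (-x) q * qPochInf (q ^ 2) (q ^ 2) =
      theta (x ^ 2) (q ^ 2) * qPochInf q q ^ 2 := by
  rw [theta, theta, theta, div_neg, ← div_pow, ← qPochInf_mul_qPochInf_neg hq1 x,
    ← qPochInf_mul_qPochInf_neg hq1 (q / x)]
  ring

theorem theta_self_pow_four_mul (hq1 : ‖q‖ < 1) (hq0 : q ≠ 0) :
    theta q (q ^ 4) * qPochInf (q ^ 2) (q ^ 2) = qPochInf q q * qPochInf (q ^ 4) (q ^ 4) := by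
  have hsq := qPochInf_mul_qPochInf_self_mul (norm_pow_lt_one hq1 two_ne_zero) q
  have hdiv : q ^ 4 / q = q ^ 2 * q := by field_simp
  simp only [← pow_mul, Nat.reduceMul] at hsq
  rw [theta, hdiv, ← qPochInf_mul_qPochInf_self_mul hq1 q, ← hsq, ← sq]
  ring

theorem theta_mul_theta_neg_mul_theta_neg_sq (hq1 : ‖q‖ < 1) (hq0 : q ≠ 0) :
    theta q (q ^ 4) * theta (-q) (q ^ 4) * theta (-q ^ 2) (q ^ 8) =
      qPochInf (q ^ 4) (q ^ 4) ^ 3 := by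
  have h₁ := theta_mul_theta_neg (norm_pow_lt_one hq1 four_ne_zero) q
  have h₂ := theta_mul_theta_neg (norm_pow_lt_one hq1 (m := 8) (by norm_num)) (q ^ 2)
  have h₃ := theta_self_pow_four_mul (norm_pow_lt_one hq1 four_ne_zero) (pow_ne_zero 4 hq0)
  simp only [← pow_mul, Nat.reduceMul] at h₁ h₂ h₃
  have h8 := qPochInf_self_ne_zero (norm_pow_lt_one hq1 (m := 8) (by norm_num))
  have h16 := qPochInf_self_ne_zero (norm_pow_lt_one hq1 (m := 16) (by norm_num))
  refine mul_right_cancel₀ (mul_ne_zero h8 h16) ?_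
  linear_combination (theta (-q ^ 2) (q ^ 8) * qPochInf (q ^ 16) (q ^ 16)) * h₁ +
    qPochInf (q ^ 4) (q ^ 4) ^ 2 * h₂ +
    qPochInf (q ^ 4) (q ^ 4) ^ 2 * qPochInf (q ^ 8) (q ^ 8) * h₃

theorem theta_quotient_eq (hq1 : ‖q‖ < 1) (hq0 : q ≠ 0) :
    theta (-q ^ 4) (q ^ 16) ^ 2 * qPochInf (q ^ 4) (q ^ 4) ^ 2 /
        (theta q (q ^ 4) * theta (-q ^ 6) (q ^ 16) * theta (-q ^ 14) (q ^ 16)) =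
      theta (-q ^ 4) (q ^ 8) * theta (-q) (q ^ 4) / qPochInf (q ^ 4) (q ^ 4) := by
  have hq8 := norm_pow_lt_one hq1 (m := 8) (by norm_num)
  have hq80 := pow_ne_zero 8 hq0
  have h₁ := theta_mul_theta_self_mul hq8 hq80 (-q ^ 4)
  have h₂ := theta_mul_theta_self_mul hq8 hq80 (-q ^ 6)
  have h₃ := theta_mul_theta_neg_mul_theta_neg_sq hq1 hq0
  have hrefl₁ : theta (q ^ 8 * -q ^ 4) (q ^ 16) = theta (-q ^ 4) (q ^ 16) := by
    rw [← theta_self_div (pow_ne_zero 16 hq0)]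
    congr 1
    field_simp
  have hrefl₂ : theta (-q ^ 6) (q ^ 8) = theta (-q ^ 2) (q ^ 8) := by
    rw [← theta_self_div hq80]
    congr 1
    field_simp
  have hmul : q ^ 8 * -q ^ 6 = -q ^ 14 := by ring
  rw [← pow_mul, hrefl₁] at h₁
  rw [← pow_mul, hmul, hrefl₂] at h₂
  have hP4 := qPochInf_self_ne_zero (norm_pow_lt_one hq1 four_ne_zero)
  have hP8 := qPochInf_self_ne_zero hq8
  have hP16 := qPochInf_self_ne_zero (norm_pow_lt_one hq1 (m := 16) (by norm_num))
  have hθ : theta q (q ^ 4) * theta (-q) (q ^ 4) * theta (-q ^ 2) (q ^ 8) ≠ 0 :=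
    h₃ ▸ pow_ne_zero 3 hP4
  have hB := mul_ne_zero (right_ne_zero_of_mul hθ) (pow_ne_zero 2 hP16)
  rw [← h₂] at hB
  rw [mul_assoc (theta q _), div_eq_div_iff (mul_ne_zero
    (left_ne_zero_of_mul (left_ne_zero_of_mul hθ)) (left_ne_zero_of_mul hB)) hP4]
  refine mul_right_cancel₀ hP8 ?_
  linear_combination qPochInf (q ^ 4) (q ^ 4) ^ 3 * h₁ -
    theta (-q ^ 4) (q ^ 8) * theta (-q) (q ^ 4) * theta q (q ^ 4) * h₂ -
    theta (-q ^ 4) (q ^ 8) * qPochInf (q ^ 16) (q ^ 16) ^ 2 * h₃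

end ThetaProducts

section Dissection

theorem thetaTerm_two_mul (hq0 : q ≠ 0) (x : ℂ) (k : ℤ) :
    thetaTerm x q (2 * k) = thetaTerm (-q * x ^ 2) (q ^ 4) k := by
  have htri : tri (2 * k) = 4 * tri k - k := by
    linarith [two_mul_tri (2 * k), two_mul_tri k]
  have hbase : -(-q * x ^ 2 / q ^ 4) = (-(x / q)) ^ 2 * q⁻¹ := by
    field_simp
  rw [thetaTerm, thetaTerm, hbase, mul_zpow, htri, zpow_sub₀ hq0, zpow_mul, zpow_mul, inv_zpow]
  norm_cast
  ring

theorem thetaTerm_two_mul_add_one (hq0 : q ≠ 0) (hx : x ≠ 0) (k : ℤ) :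
    thetaTerm x q (2 * k + 1) = -x * thetaTerm (-q ^ 3 * x ^ 2) (q ^ 4) k := by
  have htri : tri (2 * k + 1) = 4 * tri k + k + 1 := by
    linarith [two_mul_tri (2 * k + 1), two_mul_tri k]
  have hbase : -(-q ^ 3 * x ^ 2 / q ^ 4) = (-(x / q)) ^ 2 * q := by
    field_simp
  rw [thetaTerm, thetaTerm, hbase, mul_zpow, htri, zpow_add₀ hq0, zpow_add₀ hq0, zpow_mul,
    zpow_add₀ (neg_ne_zero.2 (div_ne_zero hx hq0)), zpow_mul, zpow_one, zpow_one]
  norm_cast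
  field_simp

theorem hasSum_int_even_add_odd {f : ℤ → ℂ} {a b : ℂ} (heven : HasSum (fun k => f (2 * k)) a)
    (hodd : HasSum (fun k => f (2 * k + 1)) b) : HasSum f (a + b) := by
  have hinj₀ : Function.Injective fun k : ℤ => 2 * k := mul_right_injective₀ two_ne_zero
  have hinj₁ : Function.Injective fun k : ℤ => 2 * k + 1 := (add_left_injective 1).comp hinj₀
  have hrange := Int.isCompl_even_odd
  rw [← range_two_mul, ← range_two_mul_add_one] at hrange
  exact (hinj₀.hasSum_range_iff.2 heven).add_isCompl hrange (hinj₁.hasSum_range_iff.2 hodd)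

theorem theta_eq_theta_sub_mul_theta (hq1 : ‖q‖ < 1) (hq0 : q ≠ 0) (hx : x ≠ 0) :
    theta x q = theta (-q * x ^ 2) (q ^ 4) - x * theta (-q ^ 3 * x ^ 2) (q ^ 4) := by
  have hq4 := norm_pow_lt_one hq1 four_ne_zero
  have hx2 := pow_ne_zero 2 hx
  have heven := (hasSum_thetaTerm hq4 (pow_ne_zero 4 hq0)
    (mul_ne_zero (neg_ne_zero.2 hq0) hx2)).congr_fun (thetaTerm_two_mul hq0 x)
  have hodd := ((hasSum_thetaTerm hq4 (pow_ne_zero 4 hq0)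
    (mul_ne_zero (neg_ne_zero.2 (pow_ne_zero 3 hq0)) hx2)).mul_left (-x)).congr_fun
      (thetaTerm_two_mul_add_one hq0 hx)
  have hsum := hasSum_int_even_add_odd heven hodd
  rw [(hasSum_thetaTerm hq1 hq0 hx).unique hsum]
  ring

theorem mul_g_pow_four_eq (hq1 : ‖q‖ < 1) (hq0 : q ≠ 0) :
    q * g q (q ^ 4) = -1 + q ^ 2 * g (-q ^ 2) (q ^ 16) - q ^ 5 * g (-q ^ 6) (q ^ 16) +
      theta (-q ^ 4) (q ^ 8) * (theta (-q ^ 6) (q ^ 16) + q * theta (-q ^ 2) (q ^ 16)) /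
        qPochInf (q ^ 4) (q ^ 4) := by
  have hq4 := norm_pow_lt_one hq1 four_ne_zero
  have hq40 := pow_ne_zero 4 hq0
  have hnorm (j : ℕ) : ‖-q ^ j‖ = ‖q‖ ^ j := by rw [norm_neg, norm_pow]
  have hnot (j : ℕ) (hj : ¬ 16 ∣ j) : NotPower (-q ^ j) (q ^ 16) :=
    notPower_of_norm_eq hq1 hq0 (hnorm j) hj
  have hx₁ : -q ^ 4 * q ^ 2 = -q ^ 6 := by ring
  have hx₃ : -(q ^ 4) ^ 3 * q ^ 2 = -q ^ 14 := by ring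
  have hrefl : q ^ 16 / -q ^ 2 = -q ^ 14 := by field_simp
  have hg := g_self_div (norm_pow_lt_one hq1 (m := 16) (by norm_num)) (pow_ne_zero 16 hq0)
    (neg_ne_zero.2 (pow_ne_zero 2 hq0)) (hnot 2 (by norm_num))
  have hθ := theta_self_div (pow_ne_zero 16 hq0) (-q ^ 2)
  have hdissect := theta_eq_theta_sub_mul_theta hq4 hq40 (neg_ne_zero.2 hq0)
  have hmain := mul_g_eq hq4 hq40 hq0
    (notPower_of_norm_eq hq1 hq0 (pow_one ‖q‖).symm (by norm_num))
  rw [neg_sq] at hdissect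
  rw [hrefl] at hg hθ
  simp only [← pow_mul, Nat.reduceMul] at hmain hdissect hx₃
  rw [hx₁, hx₃] at hmain hdissect
  rw [hmain (hnot 6 (by norm_num)) (hnot 14 (by norm_num)), theta_quotient_eq hq1 hq0, hdissect, hg,
    hθ]
  field_simp
  ring

end Dissection

section Fine

variable {t : ℂ}

theorem exists_norm_pow_mul_qPoch_le (hq1 : ‖q‖ < 1) (x : ℂ) :
    ∃ M : ℝ, ∀ (s : ℂ) (k n : ℕ), ‖s ^ k * qPoch x q n‖ ≤ ‖s‖ ^ k * M := by
  obtain ⟨M, hM⟩ := exists_norm_le_of_tendsto (tendsto_qPoch hq1 x)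
  refine ⟨M, fun s k n => ?_⟩
  rw [norm_mul, norm_pow]
  exact mul_le_mul_of_nonneg_left (hM n) (by positivity)

theorem summable_pow_mul_qPoch (hq1 : ‖q‖ < 1) (ht : ‖t‖ < 1) (x : ℂ) (f : ℕ → ℕ) :
    Summable fun n => t ^ n * qPoch x q (f n) := by
  obtain ⟨M, hM⟩ := exists_norm_pow_mul_qPoch_le hq1 x
  exact .of_norm_bounded ((summable_geometric_of_lt_one (norm_nonneg t) ht).mul_right M)
    fun n => hM t n (f n)

/-- Fine's function `∑ (x; q)_n t^n`. -/
noncomputable def fine (x q t : ℂ) : ℂ := ∑' n : ℕ, t ^ n * qPoch x q n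

theorem norm_mul_pow_le_of_norm_lt_one (hq1 : ‖q‖ < 1) (t : ℂ) (n : ℕ) : ‖t * q ^ n‖ ≤ ‖t‖ := by
  rw [norm_mul, norm_pow]
  exact mul_le_of_le_one_right (norm_nonneg t) (pow_le_one₀ (norm_nonneg q) hq1.le)

theorem one_sub_mul_fine (hq1 : ‖q‖ < 1) (ht : ‖t‖ < 1) (x : ℂ) :
    (1 - t) * fine x q t = 1 - x * t * fine x q (t * q) := by
  have htq : ‖t * q‖ < 1 := by
    simpa only [pow_one] using (norm_mul_pow_le_of_norm_lt_one hq1 t 1).trans_lt ht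
  have hs := summable_pow_mul_qPoch hq1 ht x fun n => n
  have hsq := summable_pow_mul_qPoch hq1 htq x fun n => n
  have hrec : fine x q t = 1 + (t * fine x q t - x * t * fine x q (t * q)) := by
    simp only [fine, ← tsum_mul_left]
    rw [← (hs.mul_left t).tsum_sub (hsq.mul_left (x * t)), hs.tsum_eq_zero_add]
    simp only [pow_zero, qPoch_zero, mul_one, qPoch_succ]
    congr! 3
    ring
  linear_combination hrec

theorem tendsto_fine_mul_pow (hq1 : ‖q‖ < 1) (ht : ‖t‖ < 1) (x : ℂ) :
    Tendsto (fun n : ℕ => fine x q (t * q ^ n)) atTop (𝓝 1) := by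
  obtain ⟨M, hM⟩ := exists_norm_pow_mul_qPoch_le hq1 x
  have hM0 : 0 ≤ M := by simpa only [pow_zero, one_mul] using (norm_nonneg _).trans (hM 0 0 0)
  refine tendsto_tsum_of_dominated_of_tendsto_zero
    ((summable_geometric_of_lt_one (norm_nonneg t) ht).mul_right M)
    (fun n k => (hM _ k k).trans ?_) 0 ?_ fun k hk => ?_
  · gcongr
    exact norm_mul_pow_le_of_norm_lt_one hq1 t n
  · simp only [pow_zero, qPoch_zero, mul_one, tendsto_const_nhds]
  · simpa only [mul_zero, zero_pow hk, zero_mul] using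
      (((tendsto_pow_atTop_nhds_zero_of_norm_lt_one hq1).const_mul t).pow k).mul_const
        (qPoch x q k)

/-- The general term `(-x t)^n q^{n (n - 1) / 2} / (t; q)_{n + 1}` of the expansion of Fine's
function obtained by iterating its functional equation. -/
noncomputable def fineExpansionTerm (x q t : ℂ) (n : ℕ) : ℂ :=
  (-x * t) ^ n * q ^ n.choose 2 / qPoch t q (n + 1)

theorem pow_mul_ne_one (hq1 : ‖q‖ < 1) (ht : ‖t‖ < 1) (i : ℕ) : q ^ i * t ≠ 1 := by
  have hlt := (norm_mul_pow_le_of_norm_lt_one hq1 t i).trans_lt ht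
  intro h
  rw [mul_comm, h, norm_one] at hlt
  exact hlt.false

theorem fineExpansionTerm_succ (x q t : ℂ) (n : ℕ) :
    fineExpansionTerm x q t (n + 1) =
      -x * t * q ^ n / (1 - q ^ (n + 1) * t) * fineExpansionTerm x q t n := by
  rw [fineExpansionTerm, fineExpansionTerm, qPoch_succ _ _ (n + 1), Nat.choose_succ_succ' n 1,
    Nat.choose_one_right, div_mul_div_comm, mul_comm (qPoch t q (n + 1))]
  ring

theorem tendsto_one_sub_pow_mul (hq1 : ‖q‖ < 1) (t : ℂ) :
    Tendsto (fun n : ℕ => 1 - q ^ n * t) atTop (𝓝 1) := by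
  simpa only [zero_mul, sub_zero] using
    ((tendsto_pow_atTop_nhds_zero_of_norm_lt_one hq1).mul_const t).const_sub 1

theorem summable_fineExpansionTerm (hq1 : ‖q‖ < 1) (x t : ℂ) :
    Summable (fineExpansionTerm x q t) := by
  have hratio : Tendsto (fun n : ℕ => ‖-x * t * q ^ n / (1 - q ^ (n + 1) * t)‖) atTop (𝓝 0) := by
    simpa only [mul_zero, zero_div, norm_zero, Pi.div_apply, Function.comp_apply] using
      (((tendsto_pow_atTop_nhds_zero_of_norm_lt_one hq1).const_mul (-x * t)).div
        ((tendsto_one_sub_pow_mul hq1 t).comp (tendsto_add_atTop_nat 1)) one_ne_zero).norm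
  refine summable_of_ratio_norm_eventually_le one_half_lt_one ?_
  filter_upwards [hratio.eventually_le_const one_half_pos] with n hn
  rw [fineExpansionTerm_succ, norm_mul]
  gcongr

theorem sum_fineExpansionTerm_add (hq1 : ‖q‖ < 1) (ht : ‖t‖ < 1) (x : ℂ) (n : ℕ) :
    ∑ i ∈ Finset.range n, fineExpansionTerm x q t i +
      fineExpansionTerm x q t n * (1 - q ^ n * t) * fine x q (t * q ^ n) = fine x q t := by
  induction n with
  | zero =>
    have h1t : 1 - t ≠ 0 := by simpa [sub_ne_zero] using (pow_mul_ne_one hq1 ht 0).symm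
    simp [fineExpansionTerm, qPoch_succ, qPoch_zero, h1t]
  | succ n ih =>
    have hlt := (norm_mul_pow_le_of_norm_lt_one hq1 t n).trans_lt ht
    have hfine := one_sub_mul_fine hq1 hlt x
    have hne : 1 - q ^ (n + 1) * t ≠ 0 := sub_ne_zero.2 (pow_mul_ne_one hq1 ht (n + 1)).symm
    rw [← ih, Finset.sum_range_succ, fineExpansionTerm_succ, pow_succ q n, ← mul_assoc t]
    rw [pow_succ] at hne
    rw [mul_right_comm _ _ (1 - q ^ n * q * t), div_mul_cancel₀ _ hne]
    linear_combination (-fineExpansionTerm x q t n) * hfine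

theorem hasSum_fineExpansionTerm (hq1 : ‖q‖ < 1) (ht : ‖t‖ < 1) (x : ℂ) :
    HasSum (fineExpansionTerm x q t) (fine x q t) := by
  have hsum := summable_fineExpansionTerm hq1 x t
  have hrem := (hsum.tendsto_atTop_zero.mul (tendsto_one_sub_pow_mul hq1 t)).mul
    (tendsto_fine_mul_pow hq1 ht x)
  have hlim := hsum.hasSum.tendsto_sum_nat.add hrem
  simp only [sum_fineExpansionTerm_add hq1 ht, mul_one, add_zero] at hlim
  exact tendsto_nhds_unique hlim tendsto_const_nhds ▸ hsum.hasSum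

end Fine

section PhiBar

theorem mul_fineExpansionTerm_sq (q : ℂ) (n : ℕ) :
    q * fineExpansionTerm (-q ^ 2) (q ^ 2) q n =
      q ^ (n + 1) ^ 2 / qPoch q (q ^ 2) (n + 1) := by
  have hpow : q * ((q ^ 2 * q) ^ n * (q ^ 2) ^ n.choose 2) = q ^ (n + 1) ^ 2 := by
    induction n with
    | zero => simp
    | succ n ih =>
      have hsq : (n + 1 + 1) ^ 2 = (n + 1) ^ 2 + (2 * n + 3) := by ring
      rw [hsq, pow_add q, ← ih, Nat.choose_succ_succ' n 1, Nat.choose_one_right]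
      ring
  rw [fineExpansionTerm, neg_neg, ← mul_div_assoc, hpow]

theorem hasSum_pow_sq_div_qPoch_sq (hq1 : ‖q‖ < 1) :
    HasSum (fun n : ℕ => q ^ n ^ 2 / qPoch q (q ^ 2) n) (1 + q * fine (-q ^ 2) (q ^ 2) q) := by
  have h := (hasSum_fineExpansionTerm (norm_pow_lt_one hq1 two_ne_zero) hq1 (-q ^ 2)).mul_left q
  simp only [mul_fineExpansionTerm_sq] at h
  simpa [qPoch_zero, add_comm] using
    (hasSum_nat_add_iff (f := fun n => q ^ n ^ 2 / qPoch q (q ^ 2) n) 1).1 h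

theorem pow_sq_div_qPoch_sq_even_add_odd (hq1 : ‖q‖ < 1) (hq0 : q ≠ 0) (n : ℕ) :
    q ^ (2 * n) ^ 2 / qPoch q (q ^ 2) (2 * n) + q ^ (2 * n + 1) ^ 2 / qPoch q (q ^ 2) (2 * n + 1) =
      (q ^ 4) ^ n ^ 2 / gDenom q (q ^ 4) n := by
  have hne : 1 - (q ^ 4) ^ n * q ≠ 0 :=
    sub_ne_zero.2 (pow_mul_ne_one (norm_pow_lt_one hq1 four_ne_zero) hq1 n).symm
  have hself : q ^ 2 * q = q ^ 4 / q := by field_simp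
  have hsplit : qPoch q (q ^ 2) (2 * n) = qPoch q (q ^ 4) n * qPoch (q ^ 4 / q) (q ^ 4) n := by
    rw [qPoch_mul, Finset.prod_range_succ, Finset.prod_range_one, pow_zero, one_mul, pow_one,
      hself, ← pow_mul]
  have heven : q ^ (2 * n) ^ 2 = (q ^ 4) ^ n ^ 2 := by ring
  have hodd : q ^ (2 * n + 1) ^ 2 = (q ^ 4) ^ n ^ 2 * ((q ^ 4) ^ n * q) := by ring
  have hpow : (q ^ 2) ^ (2 * n) = (q ^ 4) ^ n := by ring
  rw [gDenom, qPoch_succ q (q ^ 4), qPoch_succ, hsplit, hpow, heven, hodd,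
    ← mul_div_mul_right _ _ hne, ← add_div, mul_right_comm]
  congr 1
  ring

theorem tsum_even_add_odd_eq_tsum {E : Type*} [NormedAddCommGroup E] [CompleteSpace E]
    {f : ℕ → E} (hf : Summable f) : ∑' n, (f (2 * n) + f (2 * n + 1)) = ∑' n, f n := by
  have heven : Summable fun n => f (2 * n) := hf.comp_injective (mul_right_injective₀ two_ne_zero)
  have hodd : Summable fun n => f (2 * n + 1) :=
    hf.comp_injective ((add_left_injective 1).comp (mul_right_injective₀ two_ne_zero))
  rw [heven.tsum_add hodd, tsum_even_add_odd heven hodd]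

theorem fine_eq_g (hq1 : ‖q‖ < 1) (hq0 : q ≠ 0) :
    fine (-q ^ 2) (q ^ 2) q = g q (q ^ 4) := by
  have hsum := hasSum_pow_sq_div_qPoch_sq hq1
  have hpair := tsum_even_add_odd_eq_tsum hsum.summable
  simp only [pow_sq_div_qPoch_sq_even_add_odd hq1 hq0, hsum.tsum_eq] at hpair
  rw [g, hpair, neg_add_cancel_left, inv_mul_cancel_left₀ hq0]

theorem summable_phiBar0Term (hq1 : ‖q‖ < 1) : Summable (phiBar0Term q) :=
  summable_pow_mul_qPoch hq1 hq1 (-q) fun n => 2 * n + 1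

theorem summable_phiBar1Term (hq1 : ‖q‖ < 1) : Summable (phiBar1Term q) :=
  summable_pow_mul_qPoch hq1 hq1 (-q) fun n => 2 * n

theorem phiBar1_sq_add_mul_phiBar0_sq (hq1 : ‖q‖ < 1) :
    phiBar1 (q ^ 2) + q * phiBar0 (q ^ 2) = fine (-q ^ 2) (q ^ 2) q := by
  have hq2 := norm_pow_lt_one hq1 two_ne_zero
  have heven (n : ℕ) :
      q ^ (2 * n) * qPoch (-q ^ 2) (q ^ 2) (2 * n) = phiBar1Term (q ^ 2) n := by
    rw [phiBar1Term, pow_mul]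
  have hodd (n : ℕ) : q ^ (2 * n + 1) * qPoch (-q ^ 2) (q ^ 2) (2 * n + 1) =
      q * phiBar0Term (q ^ 2) n := by
    rw [phiBar0Term, pow_succ, pow_mul]
    ring
  rw [fine, ← tsum_even_add_odd_eq_tsum (summable_pow_mul_qPoch hq2 hq1 _ fun n => n)]
  simp only [heven, hodd]
  rw [(summable_phiBar1Term hq2).tsum_add ((summable_phiBar0Term hq2).mul_left q), tsum_mul_left,
    ← phiBar0, ← phiBar1]

theorem mul_phiBar0_add_mul_phiBar1_eq {p : ℂ} (hpq : p ^ 2 = q) (hp1 : ‖p‖ < 1) (hp0 : p ≠ 0) :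
    q * phiBar0 q + p * phiBar1 q =
      -1 + q * g (-q) (q ^ 8) - p * q ^ 2 * g (-q ^ 3) (q ^ 8) +
        Jbar 2 4 q * (Jbar 3 8 q + p * Jbar 1 8 q) / Jsingle 2 q := by
  subst hpq
  have hq1 := norm_pow_lt_one hp1 two_ne_zero
  have hfactor : p ^ 2 * phiBar0 (p ^ 2) + p * phiBar1 (p ^ 2) = p * g p (p ^ 4) := by
    rw [← fine_eq_g hp1 hp0, ← phiBar1_sq_add_mul_phiBar0_sq hp1]
    ring
  rw [hfactor, mul_g_pow_four_eq hp1 hp0,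
    Jsingle_eq_qPochInf hq1 (pow_ne_zero 2 hp0) two_ne_zero, Jbar, Jbar, Jbar]
  norm_cast
  simp only [← pow_mul, Nat.reduceMul]
  ring

end PhiBar

end MockTheta

/-- For `0 < |q| < 1`, the two identities, each together with the assertion that all the series
in it converge and that no denominator in it vanishes. -/
theorem theorem1p6 (q : ℂ) (hq0 : q ≠ 0) (hq1 : ‖q‖ < 1) :
    MockTheta.Jsingle 2 q ≠ 0 ∧
    (Summable (MockTheta.phiBar0Term q) ∧
      MockTheta.GDefined (-q) (q ^ 8) ∧
      q * MockTheta.phiBar0 q =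
        -1 + q * MockTheta.g (-q) (q ^ 8)
          + MockTheta.Jbar 2 4 q * MockTheta.Jbar 3 8 q / MockTheta.Jsingle 2 q) ∧
    (Summable (MockTheta.phiBar1Term q) ∧
      MockTheta.GDefined (-q ^ 3) (q ^ 8) ∧
      MockTheta.phiBar1 q =
        -q ^ 2 * MockTheta.g (-q ^ 3) (q ^ 8)
          + MockTheta.Jbar 2 4 q * MockTheta.Jbar 1 8 q / MockTheta.Jsingle 2 q) := by
  have hq8 := MockTheta.norm_pow_lt_one hq1 (m := 8) (by norm_num)
  have hq80 := pow_ne_zero 8 hq0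
  obtain ⟨p, hp⟩ : ∃ p : ℂ, p ^ 2 = q := IsAlgClosed.exists_pow_nat_eq q two_pos
  have hp0 : p ≠ 0 := by
    rintro rfl
    exact hq0 (by rw [← hp, zero_pow two_ne_zero])
  have hp1 : ‖p‖ < 1 := by
    rwa [← hp, norm_pow, pow_lt_one_iff_of_nonneg (norm_nonneg p) two_ne_zero] at hq1
  have hplus := MockTheta.mul_phiBar0_add_mul_phiBar1_eq hp hp1 hp0
  have hminus := MockTheta.mul_phiBar0_add_mul_phiBar1_eq (p := -p) (by rw [neg_sq, hp])
    (by rwa [norm_neg]) (neg_ne_zero.2 hp0)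
  refine ⟨?_, ⟨MockTheta.summable_phiBar0Term hq1, ?_, ?_⟩,
    MockTheta.summable_phiBar1Term hq1, ?_, ?_⟩
  · rw [MockTheta.Jsingle_eq_qPochInf hq1 hq0 two_ne_zero]
    exact MockTheta.qPochInf_self_ne_zero (MockTheta.norm_pow_lt_one hq1 two_ne_zero)
  · exact MockTheta.gDefined_of_notPower hq8 hq80 (neg_ne_zero.2 hq0)
      (MockTheta.notPower_of_norm_eq hq1 hq0 (j := 1) (by simp) (by norm_num))
  · linear_combination (1 / 2 : ℂ) * hplus + (1 / 2 : ℂ) * hminus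
  · exact MockTheta.gDefined_of_notPower hq8 hq80 (neg_ne_zero.2 (pow_ne_zero 3 hq0))
      (MockTheta.notPower_of_norm_eq hq1 hq0 (j := 3) (by simp) (by norm_num))
  · refine mul_left_cancel₀ hp0 ?_
    linear_combination (1 / 2 : ℂ) * hplus - (1 / 2 : ℂ) * hminus
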